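/- \textbf{Setting.} For each of two channels $\alpha,\beta$ let $\sigma^c$ be a finite union of (finite or infinite) open intervals of $\mathbb R$ with a Hilbert space $\mathcal G^c$, let $\sigma^d\subset\mathbb R\setminus\sigma^c$ be a finite set with a finite-dimensional Hilbert space $\mathcal G(\lambda)$ for each $\lambda\in\sigma^d$, put $\mathcal G(\lambda)=\mathcal G^c$ for $\lambda\in\sigma^c$, $\sigma=\sigma^d\cup\sigma^c$, and $\mathcal H=\bigoplus_{\lambda\in\sigma^d}\mathcal G(\lambda)\oplus L_2(\sigma^c,\mathcal G^c)$. We write $\int_\sigma d\lambda$ for the sum over $\sigma^d$ plus the Lebesgue integral over $\sigma^c$. $A$ is the operator of multiplication by the independent variable in $\mathcal H$ on its maximal domain and $E(\Delta)$ is multiplication by the characteristic function of the Borel set $\Delta$. Assume $|\lambda-\mu|\ge d_0>0$ for all $\lambda\in\sigma_\alpha$, $\mu\in\sigma_\beta$. For $\tau,\tau'\in\{\alpha,\beta\}$ and a kernel $F(x,y):\mathcal G_{\tau'}(y)\to\mathcal G_{\tau}(x)$ of bounded operators, $x\in\sigma_\tau$, $y\in\sigma_{\tau'}$, let $$\|F\|_{\mathcal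 B}=\sup_{x\in\sigma_\tau,\,y\in\sigma_{\tau'}}(1+|x|)^\theta(1+|y|)^\theta|F(x,y)|+\sup_{x,x'\in\sigma_\tau^c,\,y\in\sigma_{\tau'}}(1+|y|)^\theta\frac{|F(x,y)-F(x',y)|}{|x-x'|^\gamma}$$ $$+\sup_{x\in\sigma_\tau,\,y,y'\in\sigma_{\tau'}^c}(1+|x|)^\theta\frac{|F(x,y)-F(x,y')|}{|y-y'|^\gamma}+\sup_{x,x'\in\sigma_\tau^c,\,y,y'\in\sigma_{\tau'}^c}\frac{|F(x,y)-F(x',y)-F(x,y')+F(x',y')|}{|x-x'|^\gamma|y-y'|^\gamma},$$ and let $\mathcal B^{\tau\tau'}_{\theta\gamma}$ be the class of kernels with $\|F\|_{\mathcal B}<\infty$. Let $\theta>\frac12$ and $\frac12<\gamma<1$. Let $B_{\beta\alpha}:\mathcal H_\alpha\to\mathcal H_\beta$ be a bounded integral operator with a kernel in $\mathcal B^{\beta\alpha}_{\theta\gamma}$ (whose norm is denoted by $\|B_{\beta\alpha}\|_{\mathcal B}$), let $B_{\alpha\beta}=B_{\beta\alpha}^*$, and let the bounded operator $Q_{\beta\alpha}:\mathcal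 H_\alpha\to\mathcal H_\beta$ be a solution of the basic equation $$Q_{\beta\alpha}=\int_{\sigma_\beta}E_\beta(d\mu)\,B_{\beta\alpha}\,(A_\alpha+B_{\alpha\beta}Q_{\beta\alpha}-\mu)^{-1},$$ where the resolvents exist for all $\mu\in\sigma_\beta$ and the integral is the operator-norm limit of the sums $\sum_kE_\beta(\Delta_k)B_{\beta\alpha}T_k$ for piecewise constant functions approximating the resolvent in $L_\infty(\sigma_\beta)$. \textbf{Lemma.} Put $Q_{\alpha\beta}=-Q_{\beta\alpha}^*$ and assume that, with some $C_{\alpha\beta},C_{\beta\alpha}>0$, $$\|(A_\alpha+B_{\alpha\beta}Q_{\beta\alpha}-\mu)^{-1}\|\le\frac{C_{\alpha\beta}}{1+|\mu|}\ \ (\mu\in\sigma_\beta),\qquad \|(A_\beta+B_{\beta\alpha}Q_{\alpha\beta}-\lambda)^{-1}\|\le\frac{C_{\beta\alpha}}{1+|\lambda|}\ \ (\lambda\in\sigma_\alpha).$$ Then (a) $Q_{\beta\alpha}$ is an integral operator with a kernel in $\mathcal B^{\beta\alpha}_{\theta\gamma}$ and $$\|Q_{\beta\alpha}\|_{\mathcal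 B}\le\frac{c}{d_0}\,(1+d_0^{-\gamma})^2\Big\{\|B_{\beta\alpha}\|_{\mathcal B}+C_{\alpha\beta}(1+C_{\alpha\beta}^\gamma)\,C_{\beta\alpha}(1+C_{\beta\alpha}^\gamma)\,\|B_{\beta\alpha}\|_{\mathcal B}^3\Big\};$$ (b) $W_\alpha=B_{\alpha\beta}Q_{\beta\alpha}$ is an integral operator in $\mathcal H_\alpha$ with a kernel in $\mathcal B^{\alpha\alpha}_{\theta\gamma}$ and $$\|W_\alpha\|_{\mathcal B}\le c\,C_{\beta\alpha}(1+C_{\beta\alpha}^\gamma)\,\|B_{\beta\alpha}\|_{\mathcal B}^2.$$ Here $c>0$ depends only on $\theta$ and on an upper bound for the numbers of points of $\sigma_\alpha^d$ and $\sigma_\beta^d$. Moreover, without assuming the two resolvent bounds: if for some $\delta>0$ $$\|B_{\beta\alpha}\|_2:=\Big(\int_{\sigma_\beta}\!\int_{\sigma_\alpha}|B_{\beta\alpha}(\mu,\lambda)|^2\,d\lambda\,d\mu\Big)^{1/2}<d_0\min\Big\{\frac1{1+\delta},\frac{\delta}{1+\delta^2}\Big\}$$ and $\|Q_{\beta\alpha}\|\le\delta$,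 then $Q_{\beta\alpha}$ is an integral operator with a kernel in $\mathcal B^{\beta\alpha}_{\theta\gamma}$. -/

import Mathlib

open MeasureTheory
open scoped ENNReal

universe u v

noncomputable section

namespace TwoChannel

/-- Spectral data of a channel Hamiltonian in its diagonal representation: the continuous spectrum
is a union of finitely many open intervals `(lo j, hi j)` (possibly infinite) with one fibre space
`Gc`; the discrete spectrum `σd` is a finite set of points outside of these intervals, with a
finite-dimensional fibre `Gd i` over each of them. -/
structure Channel where
  n : ℕ
  lo : Fin n → EReal
  hi : Fin n → EReal
  lo_lt_hi : ∀ j, lo j < hi j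
  σd : Finset ℝ
  disjoint : ∀ x ∈ σd, ∀ j, ¬ (lo j < (x : EReal) ∧ (x : EReal) < hi j)
  Gd : ↥σd → Type u
  [normedGd : ∀ i, NormedAddCommGroup (Gd i)]
  [innerGd : ∀ i, InnerProductSpace ℂ (Gd i)]
  [finiteGd : ∀ i, FiniteDimensional ℂ (Gd i)]
  Gc : Type u
  [normedGc : NormedAddCommGroup Gc]
  [innerGc : InnerProductSpace ℂ Gc]
  [completeGc : CompleteSpace Gc]

attribute [instance] Channel.normedGd Channel.innerGd Channel.finiteGd
  Channel.normedGc Channel.innerGc Channel.completeGc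

namespace Channel

variable (C : Channel.{u})

/-- The continuous spectrum. -/
def σc : Set ℝ := ⋃ j : Fin C.n, {x : ℝ | C.lo j < (x : EReal) ∧ (x : EReal) < C.hi j}

/-- The set `σ = σd ∪ σc`. -/
def σ : Set ℝ := (C.σd : Set ℝ) ∪ C.σc

/-- The points of `σ`, as a disjoint sum of the discrete and the continuous part. -/
abbrev Pt : Type := ↥C.σd ⊕ ↥C.σc

/-- The real number underlying a point of `σ`. -/
def pos : C.Pt → ℝ
  | .inl i => (i : ℝ)
  | .inr y => (y : ℝ)

/-- The fibre space over a point of `σ`. -/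
def Fib : C.Pt → Type u
  | .inl i => C.Gd i
  | .inr _ => C.Gc

instance (x : C.Pt) : NormedAddCommGroup (C.Fib x) :=
  match x with
  | .inl i => inferInstanceAs (NormedAddCommGroup (C.Gd i))
  | .inr _ => inferInstanceAs (NormedAddCommGroup C.Gc)

instance (x : C.Pt) : InnerProductSpace ℂ (C.Fib x) :=
  match x with
  | .inl i => inferInstanceAs (InnerProductSpace ℂ (C.Gd i))
  | .inr _ => inferInstanceAs (InnerProductSpace ℂ C.Gc)

/-- Lebesgue measure on the continuous spectrum. -/
def volc : Measure ↥C.σc := Measure.comap Subtype.val volume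

/-- Integration with respect to this measure is summation over the discrete part plus Lebesgue
integration over the continuous part. -/
def meas : Measure C.Pt :=
  Measure.map Sum.inl Measure.count + Measure.map Sum.inr C.volc

/-- The Hilbert space of the channel, `⨁_{λ ∈ σd} G(λ) ⊕ L²(σc, Gc)`. -/
abbrev H : Type u := WithLp 2 (PiLp 2 C.Gd × Lp C.Gc 2 C.volc)

/-- The value of a vector of the channel space at a point of `σ`
(defined up to null sets on the continuous part). -/
def eval (f : C.H) : (x : C.Pt) → C.Fib x
  | .inl i => f.fst i
  | .inr y => f.snd y

/-- The domain of multiplication by the independent variable in the continuous component. -/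
def domC : Submodule ℂ (Lp C.Gc 2 C.volc) where
  carrier := {f | MemLp (fun y : ↥C.σc => ((y : ℝ) : ℂ) • f y) 2 C.volc}
  zero_mem' := by
    refine (memLp_congr_ae ?_).2 (MemLp.zero' (p := 2) (ε := C.Gc))
    filter_upwards [Lp.coeFn_zero C.Gc 2 C.volc] with y hy
    rw [hy, Pi.zero_apply, smul_zero]
  add_mem' := by
    intro f g hf hg
    refine (memLp_congr_ae ?_).2 (MemLp.add hf hg)
    filter_upwards [Lp.coeFn_add f g] with y hy
    rw [hy, Pi.add_apply, smul_add, Pi.add_apply]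
  smul_mem' := by
    intro c f hf
    refine (memLp_congr_ae ?_).2 (MemLp.const_smul hf c)
    filter_upwards [Lp.coeFn_smul c f] with y hy
    rw [hy, Pi.smul_apply, Pi.smul_apply, smul_comm]

/-- Multiplication by the independent variable in the continuous component. -/
def mulC : C.domC →ₗ[ℂ] Lp C.Gc 2 C.volc where
  toFun f := MemLp.toLp (fun y : ↥C.σc => ((y : ℝ) : ℂ) • f.1 y) f.2
  map_add' := by
    rintro ⟨f, hf⟩ ⟨g, hg⟩
    refine Eq.trans ?_ (MemLp.toLp_add hf hg)
    refine MemLp.toLp_congr _ _ ?_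
    filter_upwards [Lp.coeFn_add f g] with y hy
    exact (congrArg _ hy).trans (smul_add _ _ _)
  map_smul' := by
    rintro c ⟨f, hf⟩
    refine Eq.trans ?_ (MemLp.toLp_const_smul c hf)
    refine MemLp.toLp_congr _ _ ?_
    filter_upwards [Lp.coeFn_smul c f] with y hy
    exact (congrArg _ hy).trans (smul_comm _ _ _)

/-- The operator of multiplication by the independent variable, on its maximal domain. -/
def A : C.H →ₗ.[ℂ] C.H where
  domain := C.domC.comap (WithLp.sndₗ 2 ℂ (PiLp 2 C.Gd) (Lp C.Gc 2 C.volc))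
  toFun :=
    { toFun := fun f => WithLp.toLp 2
        (WithLp.toLp 2 (fun i : ↥C.σd => ((i : ℝ) : ℂ) • f.1.fst i), C.mulC ⟨f.1.snd, f.2⟩)
      map_add' := by
        rintro ⟨f, hf⟩ ⟨g, hg⟩
        apply WithLp.ofLp_injective
        refine Prod.ext ?_ (C.mulC.map_add ⟨f.snd, hf⟩ ⟨g.snd, hg⟩)
        ext i
        exact smul_add _ _ _
      map_smul' := by
        rintro c ⟨f, hf⟩
        apply WithLp.ofLp_injective
        refine Prod.ext ?_ (C.mulC.map_smul c ⟨f.snd, hf⟩)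
        ext i
        exact smul_comm _ _ _ }

/-- Multiplication of the discrete components by the characteristic function of `Δ`. -/
def projD (Δ : Set ℝ) : PiLp 2 C.Gd →L[ℂ] PiLp 2 C.Gd := by
  classical
  exact (PiLp.continuousLinearEquiv 2 ℂ C.Gd).symm.toContinuousLinearMap ∘L
    (ContinuousLinearMap.pi fun i : ↥C.σd =>
      if (i : ℝ) ∈ Δ then ContinuousLinearMap.proj (R := ℂ) (φ := C.Gd) i else 0) ∘L
    (PiLp.continuousLinearEquiv 2 ℂ C.Gd).toContinuousLinearMap

/-- The points of the continuous spectrum that lie in `Δ`. -/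
def sel (Δ : Set ℝ) : Set ↥C.σc := {y | (y : ℝ) ∈ Δ}

theorem measurableSet_sel {Δ : Set ℝ} (hΔ : MeasurableSet Δ) : MeasurableSet (C.sel Δ) :=
  measurable_subtype_coe hΔ

theorem memLp_sel (Δ : Set ℝ) (hΔ : MeasurableSet Δ) (f : Lp C.Gc 2 C.volc) :
    MemLp ((C.sel Δ).indicator (f : ↥C.σc → C.Gc)) 2 C.volc :=
  MemLp.indicator (C.measurableSet_sel hΔ) (Lp.memLp f)

/-- Multiplication of the continuous component by the characteristic function of `Δ`. -/
def projCₗ (Δ : Set ℝ) (hΔ : MeasurableSet Δ) : Lp C.Gc 2 C.volc →ₗ[ℂ] Lp C.Gc 2 C.volc where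
  toFun f := MemLp.toLp _ (C.memLp_sel Δ hΔ f)
  map_add' := by
    intro f g
    refine Eq.trans ?_ (MemLp.toLp_add _ _)
    refine MemLp.toLp_congr _ _ ?_
    filter_upwards [Lp.coeFn_add f g] with y hy
    by_cases h : y ∈ C.sel Δ
    · simpa [h] using hy
    · simp [h]
  map_smul' := by
    intro c f
    refine Eq.trans ?_ (MemLp.toLp_const_smul c _)
    refine MemLp.toLp_congr _ _ ?_
    filter_upwards [Lp.coeFn_smul c f] with y hy
    by_cases h : y ∈ C.sel Δ
    · simpa [h] using hy
    · simp [h]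

theorem projCₗ_ae (Δ : Set ℝ) (hΔ : MeasurableSet Δ) (f : Lp C.Gc 2 C.volc) :
    ∀ᵐ y ∂C.volc, C.projCₗ Δ hΔ f y = (C.sel Δ).indicator (f : ↥C.σc → C.Gc) y := by
  rw [show C.projCₗ Δ hΔ f = MemLp.toLp _ (C.memLp_sel Δ hΔ f) from rfl]
  exact MemLp.coeFn_toLp (C.memLp_sel Δ hΔ f)

theorem norm_projCₗ_le (Δ : Set ℝ) (hΔ : MeasurableSet Δ) (f : Lp C.Gc 2 C.volc) :
    ‖C.projCₗ Δ hΔ f‖ ≤ 1 * ‖f‖ := by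
  rw [one_mul]
  refine Lp.norm_le_norm_of_ae_le ?_
  filter_upwards [C.projCₗ_ae Δ hΔ f] with y hy
  rw [hy]
  exact norm_indicator_le_norm_self _ _

/-- The same operator as a bounded operator. -/
def projC (Δ : Set ℝ) (hΔ : MeasurableSet Δ) : Lp C.Gc 2 C.volc →L[ℂ] Lp C.Gc 2 C.volc :=
  (C.projCₗ Δ hΔ).mkContinuous 1 (C.norm_projCₗ_le Δ hΔ)

/-- The spectral measure `E(Δ)` of `A`: multiplication by the characteristic function of the Borel
set `Δ`. -/
def E (Δ : Set ℝ) (hΔ : MeasurableSet Δ) : C.H →L[ℂ] C.H :=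
  (WithLp.prodContinuousLinearEquiv 2 ℂ (PiLp 2 C.Gd)
      (Lp C.Gc 2 C.volc)).symm.toContinuousLinearMap ∘L
    ((C.projD Δ).prodMap (C.projC Δ hΔ)) ∘L
    (WithLp.prodContinuousLinearEquiv 2 ℂ (PiLp 2 C.Gd)
      (Lp C.Gc 2 C.volc)).toContinuousLinearMap

/-- The operator `A + W - z` with bounded `W`, on the domain of `A`. -/
def shifted (W : C.H →L[ℂ] C.H) (z : ℂ) : C.H →ₗ.[ℂ] C.H :=
  ((W - z • ContinuousLinearMap.id ℂ C.H : C.H →L[ℂ] C.H) : C.H →ₗ[ℂ] C.H) +ᵥ C.A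

/-- `R` is the bounded operator `(A + W - z)⁻¹`. -/
def IsResolventAt (W : C.H →L[ℂ] C.H) (z : ℂ) (R : C.H →L[ℂ] C.H) : Prop :=
  (∀ g : C.H, ∃ h : R g ∈ (C.shifted W z).domain, C.shifted W z ⟨R g, h⟩ = g) ∧
    ∀ f : (C.shifted W z).domain, R (C.shifted W z f) = f

/-- `(A + W - μ)⁻¹` exists and `‖(A + W - μ)⁻¹‖ ≤ K / (1 + |μ|)` for every `μ ∈ s`. -/
def ResolventBound (W : C.H →L[ℂ] C.H) (s : Set ℝ) (K : ℝ) : Prop :=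
  ∀ μ ∈ s, ∃ R : C.H →L[ℂ] C.H, C.IsResolventAt W (μ : ℂ) R ∧ ‖R‖ ≤ K / (1 + |μ|)

end Channel

section Pair

variable (D : Channel.{v}) (C : Channel.{u})

/-- The integral sum `∑ₖ E_D(Δₖ) B Tₖ` of a simple (piecewise constant) operator-valued function,
equal to `Tₖ` on `Δₖ`. -/
def spectralSum (B : C.H →L[ℂ] D.H) (T : SimpleFunc ℝ (C.H →L[ℂ] C.H)) : C.H →L[ℂ] D.H :=
  ∑ X ∈ T.range, D.E (T ⁻¹' {X}) (T.measurableSet_fiber X) ∘L B ∘L X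

/-- The `E_D`-essential supremum over `σ_D` of `‖T' μ - T μ‖` is at most `δ`. -/
def EssClose (T' T : ℝ → C.H →L[ℂ] C.H) (δ : ℝ) : Prop :=
  ∃ (N : Set ℝ) (hN : MeasurableSet N), D.E N hN = 0 ∧ ∀ μ ∈ D.σ \ N, ‖T' μ - T μ‖ ≤ δ

/-- `S = ∫_{σ_D} E_D(dμ) B T(μ)`: the function `T` lies in the `L_∞`-closure of the simple
functions, and the integral sums of simple functions approximating `T` in `L_∞` converge to `S` in
operator norm. -/
def HasSpectralIntegral (B : C.H →L[ℂ] D.H) (T : ℝ → C.H →L[ℂ] C.H) (S : C.H →L[ℂ] D.H) : Prop :=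
  (∀ δ : ℝ, 0 < δ → ∃ T' : SimpleFunc ℝ (C.H →L[ℂ] C.H), EssClose D C T' T δ) ∧
    ∀ ε : ℝ, 0 < ε → ∃ δ : ℝ, 0 < δ ∧ ∀ T' : SimpleFunc ℝ (C.H →L[ℂ] C.H),
      EssClose D C T' T δ → ‖spectralSum D C B T' - S‖ ≤ ε

/-- `Q = ∫_{σ_D} E_D(dμ) B (A_C + B* Q - μ)⁻¹`, including the existence of the resolvents for
`μ ∈ σ_D`. -/
def SolvesBasicEquation (B Q : C.H →L[ℂ] D.H) : Prop :=
  ∃ R : ℝ → C.H →L[ℂ] C.H,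
    (∀ μ ∈ D.σ, C.IsResolventAt (B.adjoint ∘L Q) (μ : ℂ) (R μ)) ∧ HasSpectralIntegral D C B R Q

/-- Operator-valued kernels `F(x, y) : G_C(y) → G_D(x)` on `σ_D × σ_C`. -/
abbrev OpKernel : Type (max u v) := (x : D.Pt) → (y : C.Pt) → C.Fib y →L[ℂ] D.Fib x

variable {D C}

/-- `T` is the integral operator with kernel `F`: for each `f`, the function `y ↦ F(x, y) f(y)` is
integrable over `σ_C` and its integral is `(T f)(x)`, for almost every `x ∈ σ_D`. -/
def IsIntegralOperator (T : C.H →L[ℂ] D.H) (F : OpKernel D C) : Prop :=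
  ∀ f : C.H, ∀ᵐ x ∂D.meas, Integrable (fun y => F x y (C.eval f y)) C.meas ∧
    D.eval (T f) x = ∫ y, F x y (C.eval f y) ∂C.meas

/-- The kernel at a point of the continuous spectrum of the first channel. -/
def OpKernel.left (F : OpKernel D C) (x : ↥D.σc) (y : C.Pt) : C.Fib y →L[ℂ] D.Gc := F (.inr x) y

/-- The kernel at a point of the continuous spectrum of the second channel. -/
def OpKernel.right (F : OpKernel D C) (x : D.Pt) (y : ↥C.σc) : C.Gc →L[ℂ] D.Fib x := F x (.inr y)

/-- The kernel at points of the continuous spectra of both channels. -/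
def OpKernel.both (F : OpKernel D C) (x : ↥D.σc) (y : ↥C.σc) : C.Gc →L[ℂ] D.Gc :=
  F (.inr x) (.inr y)

/-- The norm `‖F‖_𝓑` of the weighted Hölder class `𝓑_{θγ}`, with value `∞` outside of the class. -/
def holderNorm (θ γ : ℝ) (F : OpKernel D C) : ℝ≥0∞ :=
  (⨆ (x : D.Pt) (y : C.Pt),
    ENNReal.ofReal ((1 + |D.pos x|) ^ θ * (1 + |C.pos y|) ^ θ * ‖F x y‖)) +
  (⨆ (x : ↥D.σc) (x' : ↥D.σc) (y : C.Pt),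
    ENNReal.ofReal ((1 + |C.pos y|) ^ θ *
      (‖F.left x y - F.left x' y‖ / |(x : ℝ) - x'| ^ γ))) +
  (⨆ (x : D.Pt) (y : ↥C.σc) (y' : ↥C.σc),
    ENNReal.ofReal ((1 + |D.pos x|) ^ θ *
      (‖F.right x y - F.right x y'‖ / |(y : ℝ) - y'| ^ γ))) +
  (⨆ (x : ↥D.σc) (x' : ↥D.σc) (y : ↥C.σc) (y' : ↥C.σc),
    ENNReal.ofReal
      (‖F.both x y - F.both x' y - F.both x y' + F.both x' y'‖ /
        (|(x : ℝ) - x'| ^ γ * |(y : ℝ) - y'| ^ γ)))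

/-- Membership in the class `𝓑_{θγ}`. -/
def MemHolderClass (θ γ : ℝ) (F : OpKernel D C) : Prop := holderNorm θ γ F < ∞

/-- The Hilbert-Schmidt norm `(∫∫ |F(x, y)|² dx dy)^{1/2}` of the kernel. -/
def hsNorm (F : OpKernel D C) : ℝ≥0∞ :=
  (∫⁻ x, ∫⁻ y, ‖F x y‖ₑ ^ 2 ∂C.meas ∂D.meas) ^ (1 / 2 : ℝ)

end Pair

end TwoChannel

end

/-! Write `D` for the channel of `β` and `C` for that of `α`, and let `X(x) = B(x, ·)` and `Y(y) =
B*(y, ·)` be the rows of the kernels, seen as bounded operators into the fibres. Since the weight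
`(1 + |x|)^(-θ)` is square integrable for `θ > 1/2`, Cauchy-Schwarz makes these rows bounded by the
weight and Hölder continuous in the base point.

The basic equation says pointwise that `(Q f)(x) = X(x) R(x) f` with `R(x) = (A_C + B*Q - x)⁻¹`
(`eval_spectralIntegral`). This already gives Hölder regularity in `x`; regularity in `y` needs a
dual formula. Applying the resolvent to its defining relation yields the Riccati equation for `Q`
(`graph_riccati`). Its adjoint holds on the domain of `A_D`, because `A_C` is self-adjoint
(`graph_riccati_adjoint`), and it forces `(Q* h)(y) = P(y) h`, where `P(y) = -Y(y) S(y)` and `S(y) =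
(A_D - B Q* - y)⁻¹` (`eval_adjoint`). Uniqueness there comes from localising to short spectral cells
(`eq_zero_of_diagonal`).

Now `B*Q` has the kernel `Y(x) P(y)*`. In `Q` itself the resolvent is expanded once around the free
one, `R = F - R B*Q F` with `F = (A_C - x)⁻¹`. As `F` is division by `y - x`, the kernel of `Q` is
`(b(x, y) - X(x) R(x) B* P(y)*) / (y - x)`. Products `X(x) Z(y)*` satisfy all four estimates of the
class because their mixed differences factor (`IsHolderFamily.compKernel`), and division by `y - x`
costs only powers of the gap (`KernelBound.cauchy`).

For the last claim, the Hilbert-Schmidt bound makes both perturbations smaller in norm than the gap,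
so a Neumann series supplies uniformly bounded resolvents and the same argument applies. -/

noncomputable section

namespace TwoChannel

/-! ### Pointwise calculus in a channel space and the graph of `A` -/

namespace Channel

variable (C : Channel.{u})

instance (x : C.Pt) : CompleteSpace (C.Fib x) :=
  match x with
  | .inl i => inferInstanceAs (CompleteSpace (C.Gd i))
  | .inr _ => inferInstanceAs (CompleteSpace C.Gc)

theorem isOpen_σc : IsOpen C.σc := by
  refine isOpen_iUnion fun j => ?_
  exact (isOpen_lt continuous_const continuous_coe_real_ereal).inter
    (isOpen_lt continuous_coe_real_ereal continuous_const)

theorem measurableSet_σc : MeasurableSet C.σc := C.isOpen_σc.measurableSet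

instance : SigmaFinite C.volc := by
  have h : Measure.map Subtype.val C.volc = volume.restrict C.σc :=
    map_comap_subtype_coe C.measurableSet_σc volume
  refine SigmaFinite.of_map C.volc (f := Subtype.val) measurable_subtype_coe.aemeasurable ?_
  rw [h]
  infer_instance

theorem measurableEmbedding_inl : MeasurableEmbedding (Sum.inl : ↥C.σd → C.Pt) :=
  ⟨Sum.inl_injective, measurable_inl, fun _ h => measurableSet_inl_image.2 h⟩

theorem measurableEmbedding_inr : MeasurableEmbedding (Sum.inr : ↥C.σc → C.Pt) :=
  ⟨Sum.inr_injective, measurable_inr, fun _ h => measurableSet_inr_image.2 h⟩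

instance : SFinite C.meas := by unfold meas; infer_instance

theorem ae_meas_iff {p : C.Pt → Prop} :
    (∀ᵐ x ∂C.meas, p x) ↔ (∀ i, p (.inl i)) ∧ ∀ᵐ y ∂C.volc, p (.inr y) := by
  rw [meas, ae_add_measure_iff, C.measurableEmbedding_inl.ae_map_iff,
    C.measurableEmbedding_inr.ae_map_iff, Measure.ae_count_iff]

theorem integrable_meas_iff {G : Type*} [NormedAddCommGroup G] {F : C.Pt → G} :
    Integrable F C.meas ↔ Integrable (fun y => F (.inr y)) C.volc := by
  rw [meas, integrable_add_measure, C.measurableEmbedding_inl.integrable_map_iff,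
    C.measurableEmbedding_inr.integrable_map_iff]
  exact and_iff_right (Integrable.of_finite)

theorem integral_meas {G : Type*} [NormedAddCommGroup G] [NormedSpace ℝ G] [CompleteSpace G]
    {F : C.Pt → G}
    (hF : Integrable F C.meas) :
    ∫ x, F x ∂C.meas = ∑ i, F (.inl i) + ∫ y, F (.inr y) ∂C.volc := by
  rw [meas] at *
  rw [integrable_add_measure] at hF
  rw [integral_add_measure hF.1 hF.2, C.measurableEmbedding_inl.integral_map,
    C.measurableEmbedding_inr.integral_map, integral_count]

theorem measurable_pos : Measurable C.pos := by
  refine measurable_fun_sum ?_ ?_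
  · exact measurable_subtype_coe
  · exact measurable_subtype_coe

theorem pos_mem (x : C.Pt) : C.pos x ∈ C.σ := by
  cases x with
  | inl i => exact Or.inl i.2
  | inr y => exact Or.inr y.2

theorem eval_add (f g : C.H) : ∀ᵐ x ∂C.meas, C.eval (f + g) x = C.eval f x + C.eval g x := by
  refine C.ae_meas_iff.2 ⟨fun i => rfl, ?_⟩
  filter_upwards [Lp.coeFn_add f.snd g.snd] with y hy
  exact hy

theorem eval_sub (f g : C.H) : ∀ᵐ x ∂C.meas, C.eval (f - g) x = C.eval f x - C.eval g x := by
  refine C.ae_meas_iff.2 ⟨fun i => rfl, ?_⟩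
  filter_upwards [Lp.coeFn_sub f.snd g.snd] with y hy
  exact hy

theorem eval_zero : ∀ᵐ x ∂C.meas, C.eval (0 : C.H) x = 0 := by
  refine C.ae_meas_iff.2 ⟨fun i => rfl, ?_⟩
  filter_upwards [Lp.coeFn_zero C.Gc 2 C.volc] with y hy
  exact hy

theorem eval_smul (c : ℂ) (f : C.H) : ∀ᵐ x ∂C.meas, C.eval (c • f) x = c • C.eval f x := by
  refine C.ae_meas_iff.2 ⟨fun i => rfl, ?_⟩
  filter_upwards [Lp.coeFn_smul c f.snd] with y hy
  exact hy

variable {C}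

theorem ext_eval {f g : C.H} (h : ∀ᵐ x ∂C.meas, C.eval f x = C.eval g x) : f = g := by
  obtain ⟨hd, hc⟩ := C.ae_meas_iff.1 h
  apply WithLp.ofLp_injective
  refine Prod.ext ?_ (Lp.ext hc)
  ext i
  exact hd i

theorem integrable_inner (f g : C.H) :
    Integrable (fun x => inner ℂ (C.eval f x) (C.eval g x)) C.meas :=
  C.integrable_meas_iff.2 (L2.integrable_inner f.snd g.snd)

theorem inner_eq_integral (f g : C.H) :
    inner ℂ f g = ∫ x, inner ℂ (C.eval f x) (C.eval g x) ∂C.meas := by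
  rw [C.integral_meas (integrable_inner f g), WithLp.prod_inner_apply, PiLp.inner_apply,
    L2.inner_def]
  rfl

theorem integrable_norm_sq (f : C.H) : Integrable (fun x => ‖C.eval f x‖ ^ 2) C.meas := by
  have h := (integrable_inner f f).re
  refine h.congr (Filter.Eventually.of_forall fun x => ?_)
  exact inner_self_eq_norm_sq (𝕜 := ℂ) (C.eval f x)

theorem norm_sq_eq_integral (f : C.H) : ‖f‖ ^ 2 = ∫ x, ‖C.eval f x‖ ^ 2 ∂C.meas := by
  rw [← inner_self_eq_norm_sq (𝕜 := ℂ) f, inner_eq_integral, ← integral_re (integrable_inner f f)]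
  exact integral_congr_ae (Filter.Eventually.of_forall fun x =>
    inner_self_eq_norm_sq (𝕜 := ℂ) (C.eval f x))

/-- Square integrable sections of the fibre family. -/
def MemL2 (s : (x : C.Pt) → C.Fib x) : Prop :=
  MemLp (fun y : ↥C.σc => (s (.inr y) : C.Gc)) 2 C.volc

/-- The vector of the channel space given by a square integrable section. -/
def ofSection (s : (x : C.Pt) → C.Fib x) (hs : MemL2 s) : C.H :=
  WithLp.toLp 2 (WithLp.toLp 2 (fun i : ↥C.σd => (s (.inl i) : C.Gd i)), MemLp.toLp _ hs)

theorem eval_ofSection (s : (x : C.Pt) → C.Fib x) (hs : MemL2 s) :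
    ∀ᵐ x ∂C.meas, C.eval (ofSection s hs) x = s x := by
  refine C.ae_meas_iff.2 ⟨fun i => rfl, ?_⟩
  filter_upwards [MemLp.coeFn_toLp hs] with y hy
  exact hy

theorem memL2_eval (f : C.H) : MemL2 (C.eval f) := Lp.memLp f.snd

theorem eval_E (Δ : Set ℝ) (hΔ : MeasurableSet Δ) (f : C.H) :
    ∀ᵐ x ∂C.meas, (C.pos x ∈ Δ → C.eval (C.E Δ hΔ f) x = C.eval f x) ∧
      (C.pos x ∉ Δ → C.eval (C.E Δ hΔ f) x = 0) := by
  refine C.ae_meas_iff.2 ⟨fun i => ?_, ?_⟩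
  · constructor
    · intro h
      have h' : (i : ℝ) ∈ Δ := h
      simp [eval, E, projD, h']
      rfl
    · intro h
      have h' : (i : ℝ) ∉ Δ := h
      simp [eval, E, projD, h']
      rfl
  · filter_upwards [C.projCₗ_ae Δ hΔ f.snd] with y hy
    constructor
    · intro h
      have h' : y ∈ C.sel Δ := h
      exact hy.trans (Set.indicator_of_mem h' _)
    · intro h
      have h' : y ∉ C.sel Δ := h
      exact hy.trans (Set.indicator_of_notMem h' _)

/-- The graph of `A`, in terms of values at almost every point. -/
def Graph (f k : C.H) : Prop := ∀ᵐ x ∂C.meas, C.eval k x = (C.pos x : ℂ) • C.eval f x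

/-- The left side carries no domain condition: `k` is square integrable, so the pointwise identity
already puts `f` in the maximal domain. This lets the unbounded operator be handled as a relation,
without elements of a domain subtype. -/
theorem graph_iff {f k : C.H} : Graph f k ↔ ∃ h : f ∈ C.A.domain, C.A ⟨f, h⟩ = k := by
  constructor
  · intro h
    obtain ⟨hd, hc⟩ := C.ae_meas_iff.1 h
    have hmem : MemLp (fun y : ↥C.σc => ((y : ℝ) : ℂ) • f.snd y) 2 C.volc :=
      (memLp_congr_ae hc).1 (Lp.memLp k.snd)
    refine ⟨hmem, ext_eval (C.ae_meas_iff.2 ⟨fun i => (hd i).symm, ?_⟩)⟩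
    filter_upwards [hc, MemLp.coeFn_toLp hmem] with y hy hy'
    exact hy'.trans hy.symm
  · rintro ⟨h, rfl⟩
    refine C.ae_meas_iff.2 ⟨fun i => rfl, ?_⟩
    filter_upwards [MemLp.coeFn_toLp h] with y hy
    exact hy

theorem IsResolventAt.graph {W R : C.H →L[ℂ] C.H} {z : ℂ} (h : C.IsResolventAt W z R) (g : C.H) :
    Graph (R g) (g - W (R g) + z • R g) := by
  obtain ⟨hm, he⟩ := h.1 g
  refine graph_iff.2 ⟨hm, ?_⟩
  have : W (R g) - z • R g + C.A ⟨R g, hm⟩ = g := he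
  refine (eq_sub_of_add_eq' this).trans ?_
  abel

theorem IsResolventAt.apply {W R : C.H →L[ℂ] C.H} {z : ℂ} (h : C.IsResolventAt W z R) {f k : C.H}
    (hfk : Graph f k) : R (k + W f - z • f) = f := by
  obtain ⟨hm, he⟩ := graph_iff.1 hfk
  have h2 := h.2 ⟨f, hm⟩
  have : C.shifted W z ⟨f, hm⟩ = W f - z • f + C.A ⟨f, hm⟩ := rfl
  rw [this, he] at h2
  refine Eq.trans (congrArg R ?_) h2
  abel

theorem isResolventAt_of_graph {W R : C.H →L[ℂ] C.H} {z : ℂ}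
    (h₁ : ∀ g, Graph (R g) (g - W (R g) + z • R g))
    (h₂ : ∀ f k, Graph f k → R (k + W f - z • f) = f) : C.IsResolventAt W z R := by
  constructor
  · intro g
    obtain ⟨hm, he⟩ := graph_iff.1 (h₁ g)
    refine ⟨hm, ?_⟩
    have : C.shifted W z ⟨R g, hm⟩ = W (R g) - z • R g + C.A ⟨R g, hm⟩ := rfl
    rw [this, he]
    abel
  · rintro ⟨f, hm⟩
    have : C.shifted W z ⟨f, hm⟩ = W f - z • f + C.A ⟨f, hm⟩ := rfl
    rw [this]
    have := h₂ f _ (graph_iff.2 ⟨hm, rfl⟩)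
    refine Eq.trans (congrArg R ?_) this
    abel

end Channel

/-! ### Square integrability of the weight -/

theorem integral_mul_le_sqrt_mul_sqrt {α : Type*} [MeasurableSpace α] {μ : Measure α} {f g : α → ℝ}
    (hf₀ : ∀ x, 0 ≤ f x) (hg₀ : ∀ x, 0 ≤ g x) (hf : MemLp f 2 μ) (hg : MemLp g 2 μ) :
    ∫ x, f x * g x ∂μ ≤ √(∫ x, f x ^ 2 ∂μ) * √(∫ x, g x ^ 2 ∂μ) := by
  have h := integral_mul_le_Lp_mul_Lq_of_nonneg (p := 2) (q := 2) (μ := μ) (f := f) (g := g)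
    ⟨by norm_num, by norm_num, by norm_num⟩ (Filter.Eventually.of_forall hf₀)
    (Filter.Eventually.of_forall hg₀) (by simpa using hf) (by simpa using hg)
  simpa [Real.sqrt_eq_rpow] using h

/-- A bound for the integral of `(1 + |x|) ^ (-2 θ)` over a union of intervals and `N` points. -/
def wtConst (θ : ℝ) (N : ℕ) : ℝ := 1 + N + ∫ x : ℝ, (1 + |x|) ^ (-(2 * θ))

theorem one_le_wtConst (θ : ℝ) (N : ℕ) : 1 ≤ wtConst θ N := by
  have : 0 ≤ ∫ x : ℝ, (1 + |x|) ^ (-(2 * θ)) := integral_nonneg fun x => by positivity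
  have : (0 : ℝ) ≤ N := N.cast_nonneg
  unfold wtConst
  linarith

theorem integrable_wt {θ : ℝ} (hθ : 1 / 2 < θ) :
    Integrable (fun x : ℝ => (1 + |x|) ^ (-(2 * θ))) := by
  have h := integrable_one_add_norm (E := ℝ) (μ := volume) (r := 2 * θ) (by simp; linarith)
  simpa using h

namespace Channel

/-- The weight `(1 + |x|) ^ (-θ)` at a point of the spectrum. -/
def wt (C : Channel.{u}) (θ : ℝ) (x : C.Pt) : ℝ := (1 + |C.pos x|) ^ (-θ)

variable {C : Channel.{u}} {θ : ℝ} {N : ℕ}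

theorem wt_pos (x : C.Pt) : 0 < C.wt θ x := by unfold wt; positivity

theorem wt_le_one (hθ : 0 ≤ θ) (x : C.Pt) : C.wt θ x ≤ 1 :=
  Real.rpow_le_one_of_one_le_of_nonpos (by linarith [abs_nonneg (C.pos x)]) (by linarith)

theorem wt_sq (x : C.Pt) : C.wt θ x ^ 2 = (1 + |C.pos x|) ^ (-(2 * θ)) := by
  unfold wt
  rw [← Real.rpow_natCast, ← Real.rpow_mul (by positivity)]
  congr 1
  push_cast
  ring

theorem measurable_wt : Measurable (C.wt θ) :=
  ((continuous_const.add continuous_abs).measurable.comp C.measurable_pos).pow_const (-θ)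

theorem integrable_wt_volc (hθ : 1 / 2 < θ) :
    Integrable (fun y : ↥C.σc => (1 + |(y : ℝ)|) ^ (-(2 * θ))) C.volc :=
  (integrableOn_iff_comap_subtypeVal C.measurableSet_σc).1 (integrable_wt hθ).integrableOn

theorem integrable_wt_sq (hθ : 1 / 2 < θ) : Integrable (fun x => C.wt θ x ^ 2) C.meas := by
  simp only [wt_sq]
  exact C.integrable_meas_iff.2 (integrable_wt_volc hθ)

theorem memLp_wt (hθ : 1 / 2 < θ) : MemLp (C.wt θ) 2 C.meas :=
  (memLp_two_iff_integrable_sq measurable_wt.aestronglyMeasurable).2 (integrable_wt_sq hθ)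

theorem integral_wt_sq_le (hθ : 1 / 2 < θ) (hN : C.σd.card ≤ N) :
    ∫ x, C.wt θ x ^ 2 ∂C.meas ≤ wtConst θ N ^ 2 := by
  have h1 := one_le_wtConst θ N
  -- The summand `1` in `wtConst` makes it at least its own square root, so a single constant bounds
  -- both the integral and the `L²` norm of the weight.
  refine le_trans ?_ (le_self_pow₀ h1 two_ne_zero)
  rw [C.integral_meas (integrable_wt_sq hθ)]
  have hd : ∑ i : ↥C.σd, C.wt θ (.inl i) ^ 2 ≤ N := by
    calc ∑ i : ↥C.σd, C.wt θ (.inl i) ^ 2 ≤ ∑ _i : ↥C.σd, (1 : ℝ) :=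
          Finset.sum_le_sum fun i _ => pow_le_one₀ (wt_pos _).le (wt_le_one (by linarith) _)
      _ ≤ N := by simpa using hN
  have hc : ∫ y, C.wt θ (.inr y) ^ 2 ∂C.volc ≤ ∫ x : ℝ, (1 + |x|) ^ (-(2 * θ)) := by
    simp only [wt_sq]
    have := integral_subtype_comap (μ := volume) C.measurableSet_σc
      (fun x : ℝ => (1 + |x|) ^ (-(2 * θ)))
    refine (le_of_eq this).trans ?_
    exact setIntegral_le_integral (integrable_wt hθ)
      (Filter.Eventually.of_forall fun x => by positivity)
  unfold wtConst
  linarith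

theorem memLp_norm_eval (f : C.H) : MemLp (fun x => ‖C.eval f x‖) 2 C.meas := by
  have h := integrable_norm_sq f
  refine (memLp_two_iff_integrable_sq ?_).2 h
  have h2 := (Real.continuous_sqrt.comp_aestronglyMeasurable h.1)
  refine h2.congr (Filter.Eventually.of_forall fun x => ?_)
  simp

theorem norm_eq_sqrt (f : C.H) : ‖f‖ = √(∫ x, ‖C.eval f x‖ ^ 2 ∂C.meas) := by
  rw [← norm_sq_eq_integral, Real.sqrt_sq (norm_nonneg f)]

theorem integrable_wt_mul (hθ : 1 / 2 < θ) (f : C.H) :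
    Integrable (fun x => C.wt θ x * ‖C.eval f x‖) C.meas :=
  (memLp_wt hθ).integrable_mul (memLp_norm_eval f)

theorem integral_wt_mul_le (hθ : 1 / 2 < θ) (hN : C.σd.card ≤ N) (f : C.H) :
    ∫ x, C.wt θ x * ‖C.eval f x‖ ∂C.meas ≤ wtConst θ N * ‖f‖ := by
  refine (integral_mul_le_sqrt_mul_sqrt (fun x => (wt_pos x).le) (fun x => norm_nonneg _)
    (memLp_wt hθ) (memLp_norm_eval f)).trans ?_
  rw [← norm_eq_sqrt]
  gcongr
  exact Real.sqrt_le_iff.2 ⟨by linarith [one_le_wtConst θ N], integral_wt_sq_le hθ hN⟩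

theorem norm_le_of_ae_le_wt (hθ : 1 / 2 < θ) (hN : C.σd.card ≤ N) {a : ℝ} (ha : 0 ≤ a) {f : C.H}
    (h : ∀ᵐ x ∂C.meas, ‖C.eval f x‖ ≤ a * C.wt θ x) : ‖f‖ ≤ wtConst θ N * a := by
  have h1 := one_le_wtConst θ N
  refine (sq_le_sq₀ (norm_nonneg f) (by positivity)).1 ?_
  rw [norm_sq_eq_integral]
  calc ∫ x, ‖C.eval f x‖ ^ 2 ∂C.meas ≤ ∫ x, a ^ 2 * C.wt θ x ^ 2 ∂C.meas := by
        refine integral_mono_ae (integrable_norm_sq f) ((integrable_wt_sq hθ).const_mul _) ?_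
        filter_upwards [h] with x hx
        rw [← mul_pow]
        exact pow_le_pow_left₀ (norm_nonneg _) hx 2
    _ = a ^ 2 * ∫ x, C.wt θ x ^ 2 ∂C.meas := integral_const_mul _ _
    _ ≤ a ^ 2 * wtConst θ N ^ 2 := by gcongr; exact integral_wt_sq_le hθ hN
    _ = (wtConst θ N * a) ^ 2 := by ring

theorem norm_le_mul_of_ae_le {a : ℝ} (ha : 0 ≤ a) {f g : C.H}
    (h : ∀ᵐ x ∂C.meas, ‖C.eval f x‖ ≤ a * ‖C.eval g x‖) : ‖f‖ ≤ a * ‖g‖ := by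
  refine (sq_le_sq₀ (norm_nonneg f) (by positivity)).1 ?_
  rw [norm_sq_eq_integral, mul_pow, norm_sq_eq_integral, ← integral_const_mul]
  refine integral_mono_ae (integrable_norm_sq f) ((integrable_norm_sq g).const_mul _) ?_
  filter_upwards [h] with x hx
  simpa only [mul_pow] using pow_le_pow_left₀ (norm_nonneg _) hx 2

theorem memL2_of_le_wt (hθ : 1 / 2 < θ) {s : (x : C.Pt) → C.Fib x}
    (hs : AEStronglyMeasurable (fun y : ↥C.σc => (s (.inr y) : C.Gc)) C.volc) {a : ℝ}
    (h : ∀ x, ‖s x‖ ≤ a * C.wt θ x) : MemL2 s := by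
  have hw : MemLp (fun y : ↥C.σc => a * C.wt θ (.inr y)) 2 C.volc := by
    refine MemLp.const_mul ?_ a
    refine (memLp_two_iff_integrable_sq
      (measurable_wt.comp measurable_inr).aestronglyMeasurable).2 ?_
    exact C.integrable_meas_iff.1 (integrable_wt_sq hθ)
  refine hw.mono hs (Filter.Eventually.of_forall fun y => ?_)
  exact (h (.inr y)).trans (le_abs_self _)

/-- Norm convergence yields almost everywhere convergence along a subsequence, which must agree with
any pointwise limit of the whole sequence. -/
theorem ae_eval_eq_of_tendsto {w : ℕ → C.H} {v : C.H}
    (h : Filter.Tendsto w Filter.atTop (nhds v)) {s : (x : C.Pt) → C.Fib x}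
    (hs : ∀ᵐ x ∂C.meas, Filter.Tendsto (fun n => C.eval (w n) x) Filter.atTop (nhds (s x))) :
    ∀ᵐ x ∂C.meas, C.eval v x = s x := by
  obtain ⟨hd, hc⟩ := C.ae_meas_iff.1 hs
  refine C.ae_meas_iff.2 ⟨fun i => ?_, ?_⟩
  · refine tendsto_nhds_unique ?_ (hd i)
    have h1 : Filter.Tendsto (fun n => ((w n).fst : PiLp 2 C.Gd)) Filter.atTop (nhds v.fst) :=
      ((WithLp.continuous_fst 2 (PiLp 2 C.Gd) (Lp C.Gc 2 C.volc)).tendsto v).comp h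
    exact ((PiLp.continuous_apply 2 C.Gd i).tendsto v.fst).comp h1
  · have h1 : Filter.Tendsto (fun n => ((w n).snd : Lp C.Gc 2 C.volc)) Filter.atTop
        (nhds v.snd) :=
      ((WithLp.continuous_snd 2 (PiLp 2 C.Gd) (Lp C.Gc 2 C.volc)).tendsto v).comp h
    obtain ⟨φ, hφ, hlim⟩ := (tendstoInMeasure_of_tendsto_Lp h1).exists_seq_tendsto_ae
    filter_upwards [hlim, hc] with y hy hy'
    exact tendsto_nhds_unique (X := C.Gc) hy (hy'.comp hφ.tendsto_atTop)

/-! ### Operators given by pointwise formulas -/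

theorem exists_clm_of_sections {H' : Type*} [NormedAddCommGroup H'] [NormedSpace ℂ H']
    (s : H' → (x : C.Pt) → C.Fib x) (hs : ∀ h, MemL2 (s h))
    (hadd : ∀ h h', ∀ᵐ x ∂C.meas, s (h + h') x = s h x + s h' x)
    (hsmul : ∀ (c : ℂ) (h : H'), ∀ᵐ x ∂C.meas, s (c • h) x = c • s h x) {a : ℝ}
    (hb : ∀ h, ‖ofSection (s h) (hs h)‖ ≤ a * ‖h‖) :
    ∃ T : H' →L[ℂ] C.H, ∀ h, ∀ᵐ x ∂C.meas, C.eval (T h) x = s h x := by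
  refine ⟨LinearMap.mkContinuous
    { toFun := fun h => ofSection (s h) (hs h)
      map_add' := fun h h' => ext_eval ?_
      map_smul' := fun c h => ext_eval ?_ } a hb, fun h => eval_ofSection _ (hs h)⟩
  · filter_upwards [eval_ofSection _ (hs (h + h')), eval_ofSection _ (hs h),
      eval_ofSection _ (hs h'), hadd h h', C.eval_add (ofSection _ (hs h)) (ofSection _ (hs h'))]
      with x h1 h2 h3 h4 h5
    rw [h1, h4, h5, h2, h3]
  · filter_upwards [eval_ofSection _ (hs (c • h)), eval_ofSection _ (hs h), hsmul c h,
      C.eval_smul c (ofSection _ (hs h))] with x h1 h2 h3 h4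
    rw [h1, h3, RingHom.id_apply, h4, h2]

theorem exists_mul {m : C.Pt → ℂ} (hm : Measurable m) {a : ℝ} (ha : 0 ≤ a)
    (hb : ∀ x, ‖m x‖ ≤ a) :
    ∃ S : C.H →L[ℂ] C.H, ‖S‖ ≤ a ∧ ∀ f, ∀ᵐ x ∂C.meas, C.eval (S f) x = m x • C.eval f x := by
  have hmem : ∀ f : C.H, MemL2 (fun x => m x • C.eval f x) := by
    intro f
    have h1 : MemLp (fun y => a • (f.snd : ↥C.σc → C.Gc) y) 2 C.volc :=
      MemLp.const_smul (memL2_eval f) a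
    refine h1.mono ?_ (Filter.Eventually.of_forall fun y => ?_)
    · exact (hm.comp measurable_inr).aestronglyMeasurable.smul (Lp.aestronglyMeasurable f.snd)
    · rw [norm_smul, Real.norm_of_nonneg ha]
      refine (norm_smul_le _ _).trans ?_
      exact mul_le_mul_of_nonneg_right (hb (.inr y)) (norm_nonneg _)
  have hn : ∀ f : C.H, ‖ofSection _ (hmem f)‖ ≤ a * ‖f‖ := by
    intro f
    refine norm_le_mul_of_ae_le ha ?_
    filter_upwards [eval_ofSection _ (hmem f)] with x hx
    rw [hx, norm_smul]
    exact mul_le_mul_of_nonneg_right (hb x) (norm_nonneg _)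
  obtain ⟨S, hS⟩ := exists_clm_of_sections (fun (f : C.H) x => m x • C.eval f x) hmem
    (fun f g => by
      filter_upwards [C.eval_add f g] with x hx
      rw [hx, smul_add])
    (fun c f => by
      filter_upwards [C.eval_smul c f] with x hx
      rw [hx, smul_comm]) hn
  refine ⟨S, ContinuousLinearMap.opNorm_le_bound _ ha fun f => ?_, hS⟩
  refine norm_le_mul_of_ae_le ha ?_
  filter_upwards [hS f] with x hx
  rw [hx, norm_smul]
  exact mul_le_mul_of_nonneg_right (hb x) (norm_nonneg _)

theorem exists_free_resolvent {z : ℂ} {d : ℝ} (hd : 0 < d) (hz : ∀ x, d ≤ ‖(C.pos x : ℂ) - z‖) :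
    ∃ S : C.H →L[ℂ] C.H, ‖S‖ ≤ 1 / d ∧
      (∀ f, ∀ᵐ x ∂C.meas, C.eval (S f) x = ((C.pos x : ℂ) - z)⁻¹ • C.eval f x) ∧
      (∀ g, Graph (S g) (g + z • S g)) ∧ ∀ f k, Graph f k → S (k - z • f) = f := by
  have hne : ∀ x, (C.pos x : ℂ) - z ≠ 0 := fun x => norm_pos_iff.1 (hd.trans_le (hz x))
  obtain ⟨S, hS, hSe⟩ := exists_mul (C := C) (m := fun x => ((C.pos x : ℂ) - z)⁻¹) (a := 1 / d)
    ((Complex.measurable_ofReal.comp C.measurable_pos).sub_const z).inv (by positivity)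
    (fun x => by
      rw [norm_inv, one_div]
      exact inv_anti₀ hd (hz x))
  refine ⟨S, hS, hSe, fun g => ?_, fun f k hfk => ext_eval ?_⟩
  · filter_upwards [hSe g, C.eval_add g (z • S g), C.eval_smul z (S g)] with x h1 h2 h3
    rw [h2, h3, h1, smul_smul, smul_smul]
    nth_rewrite 1 [← one_smul ℂ (C.eval g x)]
    rw [← add_smul]
    congr 1
    field_simp [hne x]
    ring
  · filter_upwards [hSe (k - z • f), C.eval_sub k (z • f), C.eval_smul z f, hfk] with x h1 h2 h3 h4
    rw [h1, h2, h3, h4, ← sub_smul, smul_smul, inv_mul_cancel₀ (hne x), one_smul]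

/-- A set with `E(S) = 0` need not be null: it may carry trivial fibres. Almost every point of such
a set has fibre `0`, and this is enough since any two values in that fibre coincide. -/
theorem ae_notMem_or_subsingleton (hθ : 1 / 2 < θ) {S : Set ℝ} (hS : MeasurableSet S)
    (h : C.E S hS = 0) : ∀ᵐ x ∂C.meas, C.pos x ∉ S ∨ ∀ v : C.Fib x, v = 0 := by
  have key : ∀ s : (x : C.Pt) → C.Fib x, MemL2 s → ∀ᵐ x ∂C.meas, C.pos x ∈ S → s x = 0 := by
    intro s hs
    have h0 := eval_E S hS (ofSection s hs)
    rw [h] at h0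
    filter_upwards [h0, eval_ofSection s hs, C.eval_zero] with x h1 h2 h3 hx
    rw [← h2, ← h1.1 hx]
    exact h3
  refine C.ae_meas_iff.2 ⟨fun i => ?_, ?_⟩
  · by_contra! hc
    obtain ⟨hx, v, hv⟩ := hc
    let s : (x : C.Pt) → C.Fib x := fun x => match x with
      | .inl j => (Pi.single (M := C.Gd) i (v : C.Gd i) j : C.Gd j)
      | .inr _ => (0 : C.Gc)
    have hs : MemL2 s := MemLp.zero
    have := (C.ae_meas_iff.1 (key s hs)).1 i hx
    exact hv ((Pi.single_eq_same (M := C.Gd) i (v : C.Gd i)).symm.trans this)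
  · by_cases hG : ∀ v : C.Gc, v = 0
    · exact Filter.Eventually.of_forall fun y => Or.inr hG
    · push Not at hG
      obtain ⟨v, hv⟩ := hG
      -- A constant section may fail to be square integrable on an unbounded spectrum; multiplying
      -- by the nowhere vanishing weight repairs this.
      let s : (x : C.Pt) → C.Fib x := fun x => match x with
        | .inl j => (0 : C.Gd j)
        | .inr y => (((C.wt θ (.inr y) : ℝ) : ℂ) • v : C.Gc)
      have hmeas : Measurable fun y : ↥C.σc => ((C.wt θ (.inr y) : ℝ) : ℂ) :=
        Complex.measurable_ofReal.comp (measurable_wt.comp measurable_inr)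
      have hs : MemL2 s := by
        refine memL2_of_le_wt (a := ‖v‖) hθ (hmeas.aestronglyMeasurable.smul_const v) ?_
        intro x
        cases x with
        | inl i =>
          refine (norm_zero (E := C.Gd i)).le.trans ?_
          exact mul_nonneg (norm_nonneg _) (wt_pos _).le
        | inr y =>
          refine (norm_smul ((C.wt θ (.inr y) : ℝ) : ℂ) v).le.trans ?_
          rw [Complex.norm_real, Real.norm_of_nonneg (wt_pos _).le, mul_comm]
      filter_upwards [(C.ae_meas_iff.1 (key s hs)).2] with y hy
      refine Or.inl fun hm => ?_
      rcases smul_eq_zero.1 (hy hm : ((C.wt θ (.inr y) : ℝ) : ℂ) • v = 0) with h1 | h1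
      · exact (wt_pos (C := C) (θ := θ) (.inr y)).ne' (by exact_mod_cast h1)
      · exact hv h1

/-- This is the self-adjointness of `A`: a vector in the domain of the adjoint lies in the domain of
`A`. Spectral truncation to `|x| ≤ n` makes everything bounded, and the union over `n` recovers
almost every point. -/
theorem graph_of_inner_eq {v k : C.H}
    (h : ∀ f l, Graph f l → inner ℂ l v = inner ℂ f k) : Graph v k := by
  have key : ∀ n : ℕ, ∀ᵐ x ∂C.meas, |C.pos x| ≤ n →
      C.eval k x = (C.pos x : ℂ) • C.eval v x := by
    intro n
    have hD : MeasurableSet {x : C.Pt | |C.pos x| ≤ n} :=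
      measurableSet_le (continuous_abs.measurable.comp C.measurable_pos) measurable_const
    have hDr : MeasurableSet {t : ℝ | |t| ≤ n} := measurableSet_le continuous_abs.measurable
      measurable_const
    obtain ⟨S, -, hS⟩ := exists_mul (C := C)
      (m := {x : C.Pt | |C.pos x| ≤ n}.indicator fun x => (C.pos x : ℂ)) (a := n)
      ((Complex.measurable_ofReal.comp C.measurable_pos).indicator hD) n.cast_nonneg
      (fun x => by
        by_cases hx : x ∈ {x : C.Pt | |C.pos x| ≤ n}
        · rw [Set.indicator_of_mem hx, Complex.norm_real]
          exact hx
        · rw [Set.indicator_of_notMem hx, norm_zero]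
          exact n.cast_nonneg)
    set P := C.E {t : ℝ | |t| ≤ n} hDr
    -- The truncated defect `x v(x) - k(x)` lies in the domain of `A`, so it may be used as a test
    -- vector against itself; the hypothesis then gives `⟨e, e⟩ = 0`.
    set e := P (S v - k) with he
    have hPe : ∀ᵐ x ∂C.meas, (|C.pos x| ≤ n → C.eval e x =
        (C.pos x : ℂ) • C.eval v x - C.eval k x) ∧ (¬ |C.pos x| ≤ n → C.eval e x = 0) := by
      filter_upwards [eval_E _ hDr (S v - k), C.eval_sub (S v) k, hS v] with x h1 h2 h3
      refine ⟨fun hx => ?_, h1.2⟩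
      rw [h1.1 hx, h2, h3, Set.indicator_of_mem (show x ∈ {x : C.Pt | |C.pos x| ≤ n} from hx)]
    have hg : Graph e (S e) := by
      filter_upwards [hPe, hS e] with x h1 h2
      by_cases hx : |C.pos x| ≤ n
      · rw [h2, Set.indicator_of_mem (show x ∈ {x : C.Pt | |C.pos x| ≤ n} from hx)]
      · rw [h2, h1.2 hx, smul_zero, smul_zero]
    have h0 := h e _ hg
    have h1 : inner ℂ e e = (0 : ℂ) := by
      have h2 : inner ℂ e e = inner ℂ (S e) v - inner ℂ e k := by
        rw [inner_eq_integral, inner_eq_integral, inner_eq_integral,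
          ← integral_sub (integrable_inner _ _) (integrable_inner _ _)]
        refine integral_congr_ae ?_
        filter_upwards [hPe, hg] with x h1 h2
        rw [h2]
        by_cases hx : |C.pos x| ≤ n
        · nth_rewrite 2 [h1.1 hx]
          rw [inner_sub_right, inner_smul_right, inner_smul_left, Complex.conj_ofReal]
        · rw [h1.2 hx]
          simp
      rw [h2, h0, sub_self]
    have h3 : e = 0 := inner_self_eq_zero.1 h1
    filter_upwards [hPe, C.eval_zero] with x h1 h2 hx
    have := h1.1 hx
    rw [h3, h2] at this
    exact (sub_eq_zero.1 this.symm).symm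
  filter_upwards [ae_all_iff.2 key] with x hx
  obtain ⟨n, hn⟩ := exists_nat_ge |C.pos x|
  exact hx n hn

end Channel

/-! ### Hölder continuity, and rows of kernels as operators -/

theorem continuous_of_holder {s : Set ℝ} {V : Type*} [NormedAddCommGroup V] {γ M : ℝ} (hγ : 0 < γ)
    {f : ↥s → V} (h : ∀ x x' : ↥s, ‖f x - f x'‖ ≤ M * |(x : ℝ) - x'| ^ γ) : Continuous f := by
  refine continuous_iff_continuousAt.2 fun a => ?_
  refine tendsto_iff_norm_sub_tendsto_zero.2 ?_
  have hlim : Filter.Tendsto (fun x : ↥s => M * |(x : ℝ) - a| ^ γ) (nhds a) (nhds 0) := by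
    have hc : Continuous fun x : ↥s => M * |(x : ℝ) - a| ^ γ :=
      continuous_const.mul ((continuous_subtype_val.sub continuous_const).abs.rpow_const
        fun _ => Or.inr hγ.le)
    have := hc.tendsto a
    simpa [Real.zero_rpow hγ.ne'] using this
  exact squeeze_zero (fun _ => norm_nonneg _) (fun x => h x a) hlim

theorem continuous_of_holder₂ {s t : Set ℝ} {V : Type*} [NormedAddCommGroup V] {γ M : ℝ}
    (hγ : 0 < γ) {f : ↥s → ↥t → V} (h₁ : ∀ x x' y, ‖f x y - f x' y‖ ≤ M * |(x : ℝ) - x'| ^ γ)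
    (h₂ : ∀ x y y', ‖f x y - f x y'‖ ≤ M * |(y : ℝ) - y'| ^ γ) :
    Continuous fun p : ↥s × ↥t => f p.1 p.2 := by
  refine continuous_iff_continuousAt.2 fun a => ?_
  refine tendsto_iff_norm_sub_tendsto_zero.2 ?_
  have hlim : Filter.Tendsto (fun p : ↥s × ↥t => M * |(p.1 : ℝ) - a.1| ^ γ +
      M * |(p.2 : ℝ) - a.2| ^ γ) (nhds a) (nhds 0) := by
    have hc : Continuous fun p : ↥s × ↥t => M * |(p.1 : ℝ) - a.1| ^ γ +
        M * |(p.2 : ℝ) - a.2| ^ γ :=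
      (continuous_const.mul (((continuous_subtype_val.comp continuous_fst).sub
        continuous_const).abs.rpow_const fun _ => Or.inr hγ.le)).add
      (continuous_const.mul (((continuous_subtype_val.comp continuous_snd).sub
        continuous_const).abs.rpow_const fun _ => Or.inr hγ.le))
    have := hc.tendsto a
    simpa [Real.zero_rpow hγ.ne'] using this
  refine squeeze_zero (fun _ => norm_nonneg _) (fun p => ?_) hlim
  calc ‖f p.1 p.2 - f a.1 a.2‖ = ‖(f p.1 p.2 - f a.1 p.2) + (f a.1 p.2 - f a.1 a.2)‖ := by
        congr 1; abel
    _ ≤ _ := (norm_add_le _ _).trans (add_le_add (h₁ _ _ _) (h₂ _ _ _))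

section Rows

variable {C : Channel.{u}} {θ γ M : ℝ} {N : ℕ}
  {G : Type*} [NormedAddCommGroup G] [NormedSpace ℂ G]

/-- A family of operators on the fibres, restricted to the continuous spectrum. -/
def contDomain (r : (y : C.Pt) → C.Fib y →L[ℂ] G) (y : ↥C.σc) : C.Gc →L[ℂ] G := r (.inr y)

/-- A family of operators on the fibres, continuous on the continuous spectrum and dominated by the
weight. -/
structure IsRow (θ M : ℝ) (r : (y : C.Pt) → C.Fib y →L[ℂ] G) : Prop where
  cont : Continuous (contDomain r)
  bound : ∀ y, ‖r y‖ ≤ M * C.wt θ y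

open Classical in
/-- The operator `f ↦ ∫ r(y) f(y) dy`. -/
def rowOp (r : (y : C.Pt) → C.Fib y →L[ℂ] G) : C.H →L[ℂ] G :=
  if h : ∃ T : C.H →L[ℂ] G, ∀ f, T f = ∫ y, r y (C.eval f y) ∂C.meas then h.choose else 0

theorem IsRow.norm_apply_le {r : (y : C.Pt) → C.Fib y →L[ℂ] G} (h : IsRow θ M r) (f : C.H)
    (y : C.Pt) : ‖r y (C.eval f y)‖ ≤ M * (C.wt θ y * ‖C.eval f y‖) := by
  rw [← mul_assoc]
  exact (r y).le_of_opNorm_le (h.bound y) _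

theorem IsRow.integrable {r : (y : C.Pt) → C.Fib y →L[ℂ] G} (h : IsRow θ M r) (hθ : 1 / 2 < θ)
    (f : C.H) : Integrable (fun y => r y (C.eval f y)) C.meas := by
  have hw := C.integrable_meas_iff.1 ((Channel.integrable_wt_mul hθ f).const_mul M)
  refine C.integrable_meas_iff.2 (hw.mono' ?_ (Filter.Eventually.of_forall fun y =>
    h.norm_apply_le f (.inr y)))
  exact (isBoundedBilinearMap_apply (𝕜 := ℂ) (E := C.Gc) (F := G)).continuous.comp_aestronglyMeasurable
    (h.cont.aestronglyMeasurable.prodMk (Lp.aestronglyMeasurable f.snd))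

theorem IsRow.norm_integral_le {r : (y : C.Pt) → C.Fib y →L[ℂ] G} (h : IsRow θ M r)
    (hθ : 1 / 2 < θ) (hN : C.σd.card ≤ N) (hM : 0 ≤ M) (f : C.H) :
    ‖∫ y, r y (C.eval f y) ∂C.meas‖ ≤ wtConst θ N * M * ‖f‖ := by
  calc ‖∫ y, r y (C.eval f y) ∂C.meas‖ ≤ ∫ y, M * (C.wt θ y * ‖C.eval f y‖) ∂C.meas :=
        norm_integral_le_of_norm_le ((Channel.integrable_wt_mul hθ f).const_mul M)
          (Filter.Eventually.of_forall (h.norm_apply_le f))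
    _ = M * ∫ y, C.wt θ y * ‖C.eval f y‖ ∂C.meas := integral_const_mul _ _
    _ ≤ M * (wtConst θ N * ‖f‖) := by
        gcongr
        exact Channel.integral_wt_mul_le hθ hN f
    _ = _ := by ring

theorem IsRow.rowOp_apply [CompleteSpace G] {r : (y : C.Pt) → C.Fib y →L[ℂ] G} (h : IsRow θ M r)
    (hθ : 1 / 2 < θ) (hM : 0 ≤ M) (f : C.H) :
    rowOp r f = ∫ y, r y (C.eval f y) ∂C.meas := by
  have hex : ∃ T : C.H →L[ℂ] G, ∀ f, T f = ∫ y, r y (C.eval f y) ∂C.meas := by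
    refine ⟨LinearMap.mkContinuous
      { toFun := fun f => ∫ y, r y (C.eval f y) ∂C.meas
        map_add' := fun f g => ?_
        map_smul' := fun c f => ?_ } _ (h.norm_integral_le (N := C.σd.card) hθ le_rfl hM),
      fun f => rfl⟩
    · rw [← integral_add (h.integrable hθ f) (h.integrable hθ g)]
      refine integral_congr_ae ?_
      filter_upwards [C.eval_add f g] with x hx
      rw [hx, map_add]
    · rw [RingHom.id_apply, ← integral_smul]
      refine integral_congr_ae ?_
      filter_upwards [C.eval_smul c f] with x hx
      rw [hx, map_smul]
  rw [rowOp, dif_pos hex]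
  exact hex.choose_spec f

theorem IsRow.norm_rowOp_le [CompleteSpace G] {r : (y : C.Pt) → C.Fib y →L[ℂ] G} (h : IsRow θ M r)
    (hθ : 1 / 2 < θ) (hN : C.σd.card ≤ N) (hM : 0 ≤ M) : ‖rowOp r‖ ≤ wtConst θ N * M := by
  have h1 := one_le_wtConst θ N
  refine ContinuousLinearMap.opNorm_le_bound _ (by positivity) fun f => ?_
  rw [h.rowOp_apply hθ hM]
  exact h.norm_integral_le hθ hN hM f

/-- The difference has its own constant `M₂`. For neighbouring rows of a kernel it is `M |x -
x'|^γ`, far better than the sum of the two constants. -/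
theorem rowOp_sub [CompleteSpace G] {M' : ℝ} {r r' : (y : C.Pt) → C.Fib y →L[ℂ] G} (h : IsRow θ M r)
    (h' : IsRow θ M' r') (hθ : 1 / 2 < θ) (hM : 0 ≤ M) (hM' : 0 ≤ M') {M₂ : ℝ} (hM₂ : 0 ≤ M₂)
    (h₂ : IsRow θ M₂ fun y => r y - r' y) :
    rowOp r - rowOp r' = rowOp fun y => r y - r' y := by
  ext f
  rw [sub_apply, h.rowOp_apply hθ hM, h'.rowOp_apply hθ hM',
    h₂.rowOp_apply hθ hM₂, ← integral_sub (h.integrable hθ f) (h'.integrable hθ f)]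
  rfl

end Rows

/-! ### Families of operators into the fibres -/

section Families

variable {C : Channel.{u}} {θ γ M : ℝ} {N : ℕ}
  {H' : Type*} [NormedAddCommGroup H'] [NormedSpace ℂ H']

/-- A family of operators into the fibres, restricted to the continuous spectrum. -/
def contRange (X : (x : C.Pt) → H' →L[ℂ] C.Fib x) (x : ↥C.σc) : H' →L[ℂ] C.Gc := X (.inr x)

/-- A family of operators into the fibres, dominated by the weight and Hölder continuous on the
continuous spectrum. -/
structure IsHolderFamily (θ γ M : ℝ) (X : (x : C.Pt) → H' →L[ℂ] C.Fib x) : Prop where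
  bound : ∀ x, ‖X x‖ ≤ M * C.wt θ x
  holder : ∀ x x' : ↥C.σc, ‖contRange X x - contRange X x'‖ ≤ M * |(x : ℝ) - x'| ^ γ

/-- Each section `x ↦ X(x) h` is continuous on the continuous spectrum and dominated by a square
integrable weight, so it is a vector of the channel space. -/
theorem IsHolderFamily.exists_clm {X : (x : C.Pt) → H' →L[ℂ] C.Fib x}
    (hX : IsHolderFamily θ γ M X) (hθ : 1 / 2 < θ) (hγ : 0 < γ) (hM : 0 ≤ M) :
    ∃ T : H' →L[ℂ] C.H, ∀ h, ∀ᵐ x ∂C.meas, C.eval (T h) x = X x h := by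
  have hc : Continuous (contRange X) :=
    continuous_of_holder hγ hX.holder
  have hb : ∀ h x, ‖X x h‖ ≤ M * ‖h‖ * C.wt θ x := fun h x =>
    ((X x).le_of_opNorm_le (hX.bound x) h).trans (by rw [mul_right_comm])
  have hmem : ∀ h, Channel.MemL2 fun x => X x h := fun h =>
    Channel.memL2_of_le_wt hθ (hc.clm_apply continuous_const).aestronglyMeasurable (hb h)
  refine Channel.exists_clm_of_sections (fun h x => X x h) hmem
    (fun h h' => Filter.Eventually.of_forall fun x => map_add _ _ _)
    (fun c h => Filter.Eventually.of_forall fun x => map_smul _ _ _)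
    (a := wtConst θ C.σd.card * M) fun h => ?_
  rw [mul_assoc]
  refine Channel.norm_le_of_ae_le_wt hθ le_rfl (by positivity) ?_
  filter_upwards [Channel.eval_ofSection _ (hmem h)] with x hx
  rw [hx]
  exact hb h x

theorem norm_le_of_eval_eq {X : (x : C.Pt) → H' →L[ℂ] C.Fib x} (hX : IsHolderFamily θ γ M X)
    (hθ : 1 / 2 < θ) (hN : C.σd.card ≤ N) (hM : 0 ≤ M) {T : H' →L[ℂ] C.H}
    (hT : ∀ h, ∀ᵐ x ∂C.meas, C.eval (T h) x = X x h) : ‖T‖ ≤ wtConst θ N * M := by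
  have h1 := one_le_wtConst θ N
  refine ContinuousLinearMap.opNorm_le_bound _ (by positivity) fun h => ?_
  rw [mul_assoc]
  refine Channel.norm_le_of_ae_le_wt hθ hN (by positivity) ?_
  filter_upwards [hT h] with x hx
  rw [hx]
  exact ((X x).le_of_opNorm_le (hX.bound x) h).trans (by rw [mul_right_comm])

end Families

/-! ### The weighted Hölder class as four pointwise estimates -/

section Kernels

variable {D : Channel.{v}} {C : Channel.{u}} {θ γ M M' : ℝ} {N : ℕ}

/-- Each of the four suprema in the norm of the weighted Hölder class is at most `M`. -/
structure KernelBound (θ γ M : ℝ) (F : OpKernel D C) : Prop where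
  bound : ∀ x y, ‖F x y‖ ≤ M * D.wt θ x * C.wt θ y
  left : ∀ x x' y, ‖F.left x y - F.left x' y‖ ≤ M * C.wt θ y * |(x : ℝ) - x'| ^ γ
  right : ∀ x y y', ‖F.right x y - F.right x y'‖ ≤ M * D.wt θ x * |(y : ℝ) - y'| ^ γ
  both : ∀ x x' y y', ‖F.both x y - F.both x' y - F.both x y' + F.both x' y'‖ ≤
    M * (|(x : ℝ) - x'| ^ γ * |(y : ℝ) - y'| ^ γ)

theorem KernelBound.mono {F : OpKernel D C} (hF : KernelBound θ γ M F) (h : M ≤ M') :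
    KernelBound θ γ M' F where
  bound x y := (hF.bound x y).trans (by
    have := Channel.wt_pos (θ := θ) x
    have := Channel.wt_pos (θ := θ) y
    gcongr)
  left x x' y := (hF.left x x' y).trans (by
    have := Channel.wt_pos (θ := θ) y
    gcongr)
  right x y y' := (hF.right x y y').trans (by
    have := Channel.wt_pos (θ := θ) x
    gcongr)
  both x x' y y' := (hF.both x x' y y').trans (by gcongr)

theorem wt_inv_mul (C : Channel.{u}) (θ : ℝ) (x : C.Pt) :
    (1 + |C.pos x|) ^ θ * C.wt θ x = 1 := by
  unfold Channel.wt
  rw [← Real.rpow_add (by positivity), add_neg_cancel, Real.rpow_zero]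

theorem KernelBound.holderNorm_le {F : OpKernel D C} (hF : KernelBound θ γ M F) (hM : 0 ≤ M) :
    holderNorm θ γ F ≤ ENNReal.ofReal (4 * M) := by
  -- When the points coincide the quotient is `a / 0 = 0`, so the estimate survives on the diagonal.
  have hdiv : ∀ {a b : ℝ}, 0 ≤ b → a ≤ M * b → a / b ≤ M := by
    intro a b hb h
    rcases hb.eq_or_lt with rfl | hb
    · simpa using hM
    · exact (div_le_iff₀ hb).2 h
  have key : holderNorm θ γ F ≤ ENNReal.ofReal M + ENNReal.ofReal M + ENNReal.ofReal M +
      ENNReal.ofReal M := by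
    unfold holderNorm
    refine add_le_add (add_le_add (add_le_add ?_ ?_) ?_) ?_
    · refine iSup₂_le fun x y => ENNReal.ofReal_le_ofReal ?_
      calc _ ≤ (1 + |D.pos x|) ^ θ * (1 + |C.pos y|) ^ θ * (M * D.wt θ x * C.wt θ y) := by
            gcongr
            exact hF.bound x y
        _ = M * ((1 + |D.pos x|) ^ θ * D.wt θ x) * ((1 + |C.pos y|) ^ θ * C.wt θ y) := by ring
        _ = M := by rw [wt_inv_mul, wt_inv_mul]; ring
    · refine iSup_le fun x => iSup₂_le fun x' y => ENNReal.ofReal_le_ofReal ?_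
      rw [← mul_div_assoc]
      refine hdiv (by positivity) ?_
      calc _ ≤ (1 + |C.pos y|) ^ θ * (M * C.wt θ y * |(x : ℝ) - x'| ^ γ) := by
            gcongr
            exact hF.left x x' y
        _ = M * ((1 + |C.pos y|) ^ θ * C.wt θ y) * |(x : ℝ) - x'| ^ γ := by ring
        _ = _ := by rw [wt_inv_mul]; ring
    · refine iSup_le fun x => iSup₂_le fun y y' => ENNReal.ofReal_le_ofReal ?_
      rw [← mul_div_assoc]
      refine hdiv (by positivity) ?_
      calc _ ≤ (1 + |D.pos x|) ^ θ * (M * D.wt θ x * |(y : ℝ) - y'| ^ γ) := by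
            gcongr
            exact hF.right x y y'
        _ = M * ((1 + |D.pos x|) ^ θ * D.wt θ x) * |(y : ℝ) - y'| ^ γ := by ring
        _ = _ := by rw [wt_inv_mul]; ring
    · refine iSup₂_le fun x x' => iSup₂_le fun y y' => ENNReal.ofReal_le_ofReal ?_
      exact hdiv (by positivity) (hF.both x x' y y')
  refine key.trans (le_of_eq ?_)
  rw [← ENNReal.ofReal_add hM hM, ← ENNReal.ofReal_add (by positivity) hM,
    ← ENNReal.ofReal_add (by positivity) hM]
  congr 1
  ring

/-- Each supremum is at most their sum. The Hölder quotients say nothing on the diagonal, but there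
the differences themselves vanish. -/
theorem MemHolderClass.kernelBound {F : OpKernel D C} (hF : MemHolderClass θ γ F) :
    KernelBound θ γ (holderNorm θ γ F).toReal F := by
  have hle : ∀ {a : ℝ}, ENNReal.ofReal a ≤ holderNorm θ γ F → a ≤ (holderNorm θ γ F).toReal :=
    fun h => ENNReal.ofReal_le_iff_le_toReal hF.ne |>.1 h
  have h1 : ∀ x y, ENNReal.ofReal ((1 + |D.pos x|) ^ θ * (1 + |C.pos y|) ^ θ * ‖F x y‖) ≤
      holderNorm θ γ F := fun x y => by
    unfold holderNorm
    refine le_trans ?_ (le_self_add.trans (le_self_add.trans le_self_add))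
    exact le_iSup₂ (f := fun (x : D.Pt) (y : C.Pt) =>
      ENNReal.ofReal ((1 + |D.pos x|) ^ θ * (1 + |C.pos y|) ^ θ * ‖F x y‖)) x y
  have h2 : ∀ x x' y, ENNReal.ofReal ((1 + |C.pos y|) ^ θ *
      (‖F.left x y - F.left x' y‖ / |(x : ℝ) - x'| ^ γ)) ≤ holderNorm θ γ F := fun x x' y => by
    unfold holderNorm
    refine le_trans ?_ (le_add_self.trans (le_self_add.trans le_self_add))
    refine le_trans ?_ (le_iSup _ x)
    exact le_iSup₂ (f := fun (x' : ↥D.σc) (y : C.Pt) => ENNReal.ofReal ((1 + |C.pos y|) ^ θ *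
      (‖F.left x y - F.left x' y‖ / |(x : ℝ) - x'| ^ γ))) x' y
  have h3 : ∀ x y y', ENNReal.ofReal ((1 + |D.pos x|) ^ θ *
      (‖F.right x y - F.right x y'‖ / |(y : ℝ) - y'| ^ γ)) ≤ holderNorm θ γ F := fun x y y' => by
    unfold holderNorm
    refine le_trans ?_ (le_add_self.trans le_self_add)
    refine le_trans ?_ (le_iSup _ x)
    exact le_iSup₂ (f := fun (y : ↥C.σc) (y' : ↥C.σc) => ENNReal.ofReal ((1 + |D.pos x|) ^ θ *
      (‖F.right x y - F.right x y'‖ / |(y : ℝ) - y'| ^ γ))) y y'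
  have h4 : ∀ x x' y y', ENNReal.ofReal
      (‖F.both x y - F.both x' y - F.both x y' + F.both x' y'‖ /
        (|(x : ℝ) - x'| ^ γ * |(y : ℝ) - y'| ^ γ)) ≤ holderNorm θ γ F := fun x x' y y' => by
    unfold holderNorm
    refine le_trans ?_ le_add_self
    refine le_trans ?_ (le_iSup₂ x x')
    exact le_iSup₂ (f := fun (y : ↥C.σc) (y' : ↥C.σc) => ENNReal.ofReal
      (‖F.both x y - F.both x' y - F.both x y' + F.both x' y'‖ /
        (|(x : ℝ) - x'| ^ γ * |(y : ℝ) - y'| ^ γ))) y y'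
  have hpos : ∀ {s t : ℝ}, s ≠ t → 0 < |s - t| ^ γ := fun h =>
    Real.rpow_pos_of_pos (abs_pos.2 (sub_ne_zero.2 h)) γ
  have hM : 0 ≤ (holderNorm θ γ F).toReal := ENNReal.toReal_nonneg
  constructor
  · intro x y
    have h := hle (h1 x y)
    calc ‖F x y‖ = ((1 + |D.pos x|) ^ θ * (1 + |C.pos y|) ^ θ * ‖F x y‖) *
          D.wt θ x * C.wt θ y := by
            linear_combination (-‖F x y‖) * (wt_inv_mul D θ x) -
              ‖F x y‖ * ((1 + |D.pos x|) ^ θ * D.wt θ x) * (wt_inv_mul C θ y)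
      _ ≤ _ := by
            have := Channel.wt_pos (θ := θ) x
            have := Channel.wt_pos (θ := θ) y
            gcongr
  · intro x x' y
    have hw := Channel.wt_pos (θ := θ) y
    by_cases hx : x = x'
    · subst hx
      rw [sub_self, norm_zero]
      positivity
    have hp := hpos (fun h => hx (Subtype.ext h) : (x : ℝ) ≠ x')
    have h := hle (h2 x x' y)
    rw [← div_le_iff₀ hp]
    calc _ = ((1 + |C.pos y|) ^ θ * (‖F.left x y - F.left x' y‖ / |(x : ℝ) - x'| ^ γ)) *
          C.wt θ y := by
            linear_combination (-(‖F.left x y - F.left x' y‖ / |(x : ℝ) - x'| ^ γ)) *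
              (wt_inv_mul C θ y)
      _ ≤ _ := by gcongr
  · intro x y y'
    have hw := Channel.wt_pos (θ := θ) x
    by_cases hx : y = y'
    · subst hx
      rw [sub_self, norm_zero]
      positivity
    have hp := hpos (fun h => hx (Subtype.ext h) : (y : ℝ) ≠ y')
    have h := hle (h3 x y y')
    rw [← div_le_iff₀ hp]
    calc _ = ((1 + |D.pos x|) ^ θ * (‖F.right x y - F.right x y'‖ / |(y : ℝ) - y'| ^ γ)) *
          D.wt θ x := by
            linear_combination (-(‖F.right x y - F.right x y'‖ / |(y : ℝ) - y'| ^ γ)) *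
              (wt_inv_mul D θ x)
      _ ≤ _ := by gcongr
  · intro x x' y y'
    by_cases hx : x = x'
    · subst hx
      rw [sub_self, zero_sub, neg_add_cancel, norm_zero]
      positivity
    by_cases hy : y = y'
    · subst hy
      rw [show F.both x y - F.both x' y - F.both x y + F.both x' y = 0 by abel, norm_zero]
      positivity
    have hp := hpos (fun h => hx (Subtype.ext h) : (x : ℝ) ≠ x')
    have hp' := hpos (fun h => hy (Subtype.ext h) : (y : ℝ) ≠ y')
    rw [← div_le_iff₀ (mul_pos hp hp')]
    exact hle (h4 x x' y y')

theorem KernelBound.continuous_right {F : OpKernel D C} (hF : KernelBound θ γ M F) (hγ : 0 < γ)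
    (x : D.Pt) : Continuous (F.right x) :=
  continuous_of_holder hγ (hF.right x)

theorem KernelBound.isRow {F : OpKernel D C} (hF : KernelBound θ γ M F) (hγ : 0 < γ) (x : D.Pt) :
    IsRow θ (M * D.wt θ x) (F x) :=
  ⟨hF.continuous_right hγ x, hF.bound x⟩

/-- Cauchy-Schwarz in the second variable turns kernel estimates into estimates of rows, at the cost
of one factor `wtConst`. -/
theorem KernelBound.isHolderFamily {F : OpKernel D C} (hF : KernelBound θ γ M F) (hθ : 1 / 2 < θ)
    (hγ : 0 < γ) (hN : C.σd.card ≤ N) (hM : 0 ≤ M) :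
    IsHolderFamily θ γ (wtConst θ N * M) fun x => rowOp (F x) := by
  have hw : ∀ x : D.Pt, 0 ≤ M * D.wt θ x := fun x => mul_nonneg hM (Channel.wt_pos x).le
  constructor
  · intro x
    rw [mul_assoc]
    exact (hF.isRow hγ x).norm_rowOp_le hθ hN (hw x)
  · intro x x'
    have hM' : 0 ≤ M * |(x : ℝ) - x'| ^ γ := by positivity
    have hd : IsRow θ (M * |(x : ℝ) - x'| ^ γ) fun y => F.left x y - F.left x' y :=
      ⟨(hF.continuous_right hγ (.inr x)).sub (hF.continuous_right hγ (.inr x')),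
        fun y => (hF.left x x' y).trans_eq (mul_right_comm _ _ _)⟩
    have h := rowOp_sub (r := F.left x) (r' := F.left x') (hF.isRow hγ (.inr x))
      (hF.isRow hγ (.inr x')) hθ (hw _) (hw _) hM' hd
    rw [mul_assoc]
    refine le_trans (le_of_eq (congrArg norm h)) ?_
    exact hd.norm_rowOp_le hθ hN hM'

theorem KernelBound.rowOp_apply {F : OpKernel D C} (hF : KernelBound θ γ M F) (hθ : 1 / 2 < θ)
    (hγ : 0 < γ) (hM : 0 ≤ M) (x : D.Pt) (f : C.H) :
    rowOp (F x) f = ∫ y, F x y (C.eval f y) ∂C.meas :=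
  (hF.isRow hγ x).rowOp_apply hθ (mul_nonneg hM (Channel.wt_pos x).le) f

theorem KernelBound.isIntegralOperator_iff {F : OpKernel D C} (hF : KernelBound θ γ M F)
    (hθ : 1 / 2 < θ) (hγ : 0 < γ) (hM : 0 ≤ M) {T : C.H →L[ℂ] D.H} :
    IsIntegralOperator T F ↔ ∀ f, ∀ᵐ x ∂D.meas, D.eval (T f) x = rowOp (F x) f := by
  refine forall_congr' fun f => Filter.eventually_congr (Filter.Eventually.of_forall fun x => ?_)
  rw [hF.rowOp_apply hθ hγ hM]
  exact and_iff_right ((hF.isRow hγ x).integrable hθ f)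

/-- The kernel of the adjoint operator. -/
def OpKernel.adj (F : OpKernel D C) : OpKernel C D := fun y x => (F x y).adjoint

theorem KernelBound.adj {F : OpKernel D C} (hF : KernelBound θ γ M F) :
    KernelBound θ γ M F.adj := by
  have hsub : ∀ {V W : Type _} [NormedAddCommGroup V] [InnerProductSpace ℂ V] [CompleteSpace V]
      [NormedAddCommGroup W] [InnerProductSpace ℂ W] [CompleteSpace W] (S T : V →L[ℂ] W),
      ‖S.adjoint - T.adjoint‖ = ‖S - T‖ := by
    intro V W _ _ _ _ _ _ S T
    rw [← map_sub, LinearIsometryEquiv.norm_map]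
  constructor
  · intro y x
    refine (LinearIsometryEquiv.norm_map _ _).trans_le ((hF.bound x y).trans_eq ?_)
    ring
  · intro y y' x
    exact (hsub (F.right x y) (F.right x y')).trans_le (hF.right x y y')
  · intro y x x'
    exact (hsub (F.left x y) (F.left x' y)).trans_le (hF.left x x' y)
  · intro y y' x x'
    have h1 : F.adj.both y x - F.adj.both y' x - F.adj.both y x' + F.adj.both y' x' =
        (F.both x y - F.both x' y - F.both x y' + F.both x' y').adjoint := by
      rw [map_add, map_sub, map_sub]
      refine Eq.trans ?_ (sub_add_eq_add_sub _ _ _).symm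
      change (F.both x y).adjoint - (F.both x y').adjoint - (F.both x' y).adjoint +
        (F.both x' y').adjoint = _
      abel
    rw [h1, LinearIsometryEquiv.norm_map]
    refine (hF.both x x' y y').trans_eq ?_
    ring

end Kernels

/-! ### The adjoint of an integral operator -/

section Adjoint

variable {D : Channel.{v}} {C : Channel.{u}} {θ γ M : ℝ}

theorem measurable_uncurry_pt {V : Type*} [MeasurableSpace V] {Φ : D.Pt × C.Pt → V}
    (hcd : ∀ j, Measurable fun x : ↥D.σc => Φ (.inr x, .inl j))
    (hdc : ∀ i, Measurable fun y : ↥C.σc => Φ (.inl i, .inr y))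
    (hcc : Measurable fun p : ↥D.σc × ↥C.σc => Φ (.inr p.1, .inr p.2)) : Measurable Φ := by
  let e := MeasurableEquiv.sumProdSum ↥D.σd ↥D.σc ↥C.σd ↥C.σc
  have h : Measurable (Φ ∘ e.symm) := by
    refine measurable_fun_sum (measurable_fun_sum ?_ ?_) (measurable_fun_sum ?_ ?_)
    · exact measurable_of_countable _
    · exact measurable_from_prod_countable_right hdc
    · exact measurable_from_prod_countable_left hcd
    · exact hcc
  have h2 : Φ = (Φ ∘ e.symm) ∘ e := by
    funext p
    simp
  rw [h2]
  exact h.comp e.measurable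

theorem KernelBound.continuous_both {F : OpKernel D C} (hF : KernelBound θ γ M F) (hθ : 0 ≤ θ)
    (hγ : 0 < γ) (hM : 0 ≤ M) : Continuous fun p : ↥D.σc × ↥C.σc => F.both p.1 p.2 := by
  refine continuous_of_holder₂ (M := M) hγ (fun x x' y => ?_) (fun x y y' => ?_)
  · refine (hF.left x x' (.inr y)).trans ?_
    have := Channel.wt_le_one (C := C) hθ (.inr y)
    gcongr
    exact mul_le_of_le_one_right hM this
  · refine (hF.right (.inr x) y y').trans ?_
    have := Channel.wt_le_one (C := D) hθ (.inr x)
    gcongr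
    exact mul_le_of_le_one_right hM this

theorem KernelBound.measurable_inner {F : OpKernel D C} (hF : KernelBound θ γ M F) (hθ : 0 ≤ θ)
    (hγ : 0 < γ) (hM : 0 ≤ M) (f : C.H) (h : D.H) :
    Measurable fun p : D.Pt × C.Pt => (inner ℂ (F p.1 p.2 (C.eval f p.2)) (D.eval h p.1) : ℂ) := by
  have hf : StronglyMeasurable fun y : ↥C.σc => (f.snd : ↥C.σc → C.Gc) y :=
    Lp.stronglyMeasurable f.snd
  have hh : StronglyMeasurable fun x : ↥D.σc => (h.snd : ↥D.σc → D.Gc) x :=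
    Lp.stronglyMeasurable h.snd
  refine measurable_uncurry_pt (fun j => ?_) (fun i => ?_) ?_
  · have h1 : Continuous fun x : ↥D.σc => F.adj.right (.inl j) x :=
      hF.adj.continuous_right hγ (.inl j)
    have h2 : StronglyMeasurable fun x : ↥D.σc =>
        (F.adj.right (.inl j) x) ((h.snd : ↥D.σc → D.Gc) x) :=
      isBoundedBilinearMap_apply.continuous.comp_stronglyMeasurable
        (h1.stronglyMeasurable.prodMk hh)
    have h3 : Measurable fun x : ↥D.σc => (inner ℂ (f.fst j)
        ((F.adj.right (.inl j) x) ((h.snd : ↥D.σc → D.Gc) x)) : ℂ) :=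
      (stronglyMeasurable_const.inner h2).measurable
    refine (congrArg Measurable (funext fun x => ?_)).mp h3
    exact ContinuousLinearMap.adjoint_inner_right (F (.inr x) (.inl j)) _ _
  · have h1 : Continuous fun y : ↥C.σc => F.right (.inl i) y := hF.continuous_right hγ (.inl i)
    have h2 : StronglyMeasurable fun y : ↥C.σc =>
        (F.right (.inl i) y) ((f.snd : ↥C.σc → C.Gc) y) :=
      isBoundedBilinearMap_apply.continuous.comp_stronglyMeasurable
        (h1.stronglyMeasurable.prodMk hf)
    exact (h2.inner (stronglyMeasurable_const (b := D.eval h (.inl i)))).measurable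
  · have h2 : StronglyMeasurable fun p : ↥D.σc × ↥C.σc =>
        (F.both p.1 p.2) ((f.snd : ↥C.σc → C.Gc) p.2) :=
      isBoundedBilinearMap_apply.continuous.comp_stronglyMeasurable
        ((hF.continuous_both hθ hγ hM).stronglyMeasurable.prodMk (hf.comp_measurable measurable_snd))
    exact (h2.inner (hh.comp_measurable measurable_fst)).measurable

theorem inner_integral_left {α : Type*} [MeasurableSpace α] {μ : Measure α} {V : Type*}
    [NormedAddCommGroup V] [InnerProductSpace ℂ V] [CompleteSpace V] {g : α → V}
    (hg : Integrable g μ) (w : V) : inner ℂ (∫ x, g x ∂μ) w = ∫ x, inner ℂ (g x) w ∂μ := by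
  rw [← inner_conj_symm, ← integral_inner hg, ← integral_conj]
  simp only [inner_conj_symm]

/-- Fubini for the scalar function `⟨F(x, y) f(y), h(x)⟩`, which is dominated by a product of two
integrable functions. The adjoint kernel first defines some bounded `T`, and the exchange of
integrals identifies `T` with the adjoint of `B`. -/
theorem KernelBound.adjoint_apply {F : OpKernel D C} (hF : KernelBound θ γ M F) (hθ : 1 / 2 < θ)
    (hγ : 0 < γ) (hM : 0 ≤ M) {B : C.H →L[ℂ] D.H} (hB : IsIntegralOperator B F) (h : D.H) :
    ∀ᵐ y ∂C.meas, C.eval (B.adjoint h) y = rowOp (F.adj y) h := by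
  have h1 := one_le_wtConst θ D.σd.card
  obtain ⟨T, hT⟩ := (hF.adj.isHolderFamily hθ hγ (N := D.σd.card) le_rfl hM).exists_clm hθ hγ
    (by positivity)
  suffices hTB : T = B.adjoint by
    rw [← hTB]
    exact hT h
  ext1 h
  refine ext_inner_left ℂ fun f => ?_
  have hint : Integrable (fun p : D.Pt × C.Pt =>
      (inner ℂ (F p.1 p.2 (C.eval f p.2)) (D.eval h p.1) : ℂ)) (D.meas.prod C.meas) := by
    have h2 := ((Channel.integrable_wt_mul hθ h).mul_prod
      (Channel.integrable_wt_mul hθ f)).const_mul M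
    refine h2.mono' (hF.measurable_inner (by linarith) hγ hM f h).aestronglyMeasurable
      (Filter.Eventually.of_forall fun p => ?_)
    refine (norm_inner_le_norm _ _).trans ?_
    calc _ ≤ M * D.wt θ p.1 * C.wt θ p.2 * ‖C.eval f p.2‖ * ‖D.eval h p.1‖ := by
          gcongr
          exact (F p.1 p.2).le_of_opNorm_le (hF.bound _ _) _
      _ = _ := by ring
  rw [ContinuousLinearMap.adjoint_inner_right, Channel.inner_eq_integral,
    Channel.inner_eq_integral]
  calc ∫ y, inner ℂ (C.eval f y) (C.eval (T h) y) ∂C.meas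
      = ∫ y, ∫ x, inner ℂ (F x y (C.eval f y)) (D.eval h x) ∂D.meas ∂C.meas := by
        refine integral_congr_ae ?_
        filter_upwards [hT h] with y hy
        rw [hy, hF.adj.rowOp_apply hθ hγ hM, ← integral_inner
          ((hF.adj.isRow hγ y).integrable hθ h)]
        refine integral_congr_ae (Filter.Eventually.of_forall fun x => ?_)
        exact ContinuousLinearMap.adjoint_inner_right (F x y) _ _
    _ = ∫ x, ∫ y, inner ℂ (F x y (C.eval f y)) (D.eval h x) ∂C.meas ∂D.meas :=
        (integral_integral_swap hint).symm
    _ = ∫ x, inner ℂ (D.eval (B f) x) (D.eval h x) ∂D.meas := by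
        refine integral_congr_ae ?_
        filter_upwards [hB f] with x hx
        rw [hx.2, inner_integral_left hx.1]

end Adjoint

/-! ### Sums, products and scalar multiples of kernels -/

section Products

variable {D : Channel.{v}} {C : Channel.{u}} {θ γ M M' : ℝ} {N : ℕ}

theorem KernelBound.add {F F' : OpKernel D C} (hF : KernelBound θ γ M F)
    (hF' : KernelBound θ γ M' F') : KernelBound θ γ (M + M') fun x y => F x y + F' x y where
  bound x y := (norm_add_le_of_le (hF.bound x y) (hF'.bound x y)).trans_eq (by ring)
  left x x' y := by
    refine le_trans (le_of_eq ?_)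
      ((norm_add_le_of_le (hF.left x x' y) (hF'.left x x' y)).trans_eq (by ring))
    exact congrArg norm (add_sub_add_comm (F.left x y) (F'.left x y) (F.left x' y) (F'.left x' y))
  right x y y' := by
    refine le_trans (le_of_eq ?_)
      ((norm_add_le_of_le (hF.right x y y') (hF'.right x y y')).trans_eq (by ring))
    exact congrArg norm
      (add_sub_add_comm (F.right x y) (F'.right x y) (F.right x y') (F'.right x y'))
  both x x' y y' := by
    refine le_trans (le_of_eq (congrArg norm ?_))
      ((norm_add_le_of_le (hF.both x x' y y') (hF'.both x x' y y')).trans_eq (by ring))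
    change (F.both x y + F'.both x y) - (F.both x' y + F'.both x' y) -
      (F.both x y' + F'.both x y') + (F.both x' y' + F'.both x' y') = _
    abel

theorem KernelBound.neg {F : OpKernel D C} (hF : KernelBound θ γ M F) :
    KernelBound θ γ M fun x y => -F x y where
  bound x y := (norm_neg _).trans_le (hF.bound x y)
  left x x' y := by
    refine le_trans (le_of_eq ?_) (hF.left x x' y)
    refine Eq.trans (congrArg norm ?_) (norm_neg _)
    exact (neg_sub_neg (F.left x y) (F.left x' y)).trans (neg_sub _ _).symm
  right x y y' := by
    refine le_trans (le_of_eq ?_) (hF.right x y y')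
    refine Eq.trans (congrArg norm ?_) (norm_neg _)
    exact (neg_sub_neg (F.right x y) (F.right x y')).trans (neg_sub _ _).symm
  both x x' y y' := by
    refine le_trans (le_of_eq ?_) (hF.both x x' y y')
    refine Eq.trans (congrArg norm ?_) (norm_neg _)
    change -F.both x y - -F.both x' y - -F.both x y' + -F.both x' y' = _
    abel

/-- The kernel `X(x) Z(y)*`. -/
def compKernel {H' : Type*} [NormedAddCommGroup H'] [InnerProductSpace ℂ H'] [CompleteSpace H']
    (X : (x : D.Pt) → H' →L[ℂ] D.Fib x) (Z : (y : C.Pt) → H' →L[ℂ] C.Fib y) : OpKernel D C :=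
  fun x y => X x ∘L (Z y).adjoint

/-- Differences in `x` and in `y` act on separate factors; in particular the mixed difference is
`(X(x) - X(x')) (Z(y) - Z(y'))*`. Every estimate is thus a product of one for `X` and one for `Z`.
-/
theorem IsHolderFamily.compKernel {H' : Type*} [NormedAddCommGroup H'] [InnerProductSpace ℂ H']
    [CompleteSpace H'] {X : (x : D.Pt) → H' →L[ℂ] D.Fib x} {Z : (y : C.Pt) → H' →L[ℂ] C.Fib y}
    (hX : IsHolderFamily θ γ M X) (hZ : IsHolderFamily θ γ M' Z) :
    KernelBound θ γ (M * M') (compKernel X Z) := by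
  have hcomp : ∀ {V W : Type _} [NormedAddCommGroup V] [InnerProductSpace ℂ V] [CompleteSpace V]
      [NormedAddCommGroup W] [InnerProductSpace ℂ W] [CompleteSpace W] (S : H' →L[ℂ] V)
      (T : H' →L[ℂ] W) {a b : ℝ}, ‖S‖ ≤ a → ‖T‖ ≤ b → ‖S ∘L T.adjoint‖ ≤ a * b := by
    intro V W _ _ _ _ _ _ S T a b ha hb
    refine (ContinuousLinearMap.opNorm_comp_le _ _).trans ?_
    rw [LinearIsometryEquiv.norm_map]
    exact mul_le_mul ha hb (norm_nonneg _) ((norm_nonneg _).trans ha)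
  constructor
  · intro x y
    exact (hcomp _ _ (hX.bound x) (hZ.bound y)).trans_eq (by ring)
  · intro x x' y
    refine le_trans (le_of_eq ?_)
      ((hcomp _ _ (hX.holder x x') (hZ.bound y)).trans_eq (by ring))
    exact congrArg norm (ContinuousLinearMap.sub_comp _ _ _).symm
  · intro x y y'
    refine le_trans (le_of_eq ?_)
      ((hcomp _ _ (hX.bound x) (hZ.holder y y')).trans_eq (by ring))
    rw [map_sub, ContinuousLinearMap.comp_sub]
    rfl
  · intro x x' y y'
    refine le_trans (le_of_eq ?_)
      ((hcomp _ _ (hX.holder x x') (hZ.holder y y')).trans_eq (by ring))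
    rw [map_sub, ContinuousLinearMap.comp_sub, ContinuousLinearMap.sub_comp,
      ContinuousLinearMap.sub_comp, ← sub_add]
    rfl

/-- The kernel multiplied by a scalar function. -/
def smulKernel (k : ℝ → ℝ → ℝ) (F : OpKernel D C) : OpKernel D C :=
  fun x y => ((k (D.pos x) (C.pos y) : ℝ) : ℂ) • F x y

/-- A discrete Leibniz rule. Each variable contributes `1` when the difference falls on `F` and `2e`
when it falls on `k`, hence `(1 + 2e)²` for the mixed difference; the other three estimates need
fewer factors and are enlarged to match. -/
theorem KernelBound.smulKernel {F : OpKernel D C} (hF : KernelBound θ γ M F) (hθ : 0 ≤ θ)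
    (hM : 0 ≤ M) {k : ℝ → ℝ → ℝ} {a e : ℝ} (ha : 0 ≤ a) (he : 0 ≤ e)
    (h0 : ∀ x ∈ D.σ, ∀ y ∈ C.σ, |k x y| ≤ a)
    (h1 : ∀ x ∈ D.σ, ∀ x' ∈ D.σ, ∀ y ∈ C.σ, |k x y - k x' y| ≤ a * (2 * e) * |x - x'| ^ γ)
    (h2 : ∀ x ∈ D.σ, ∀ y ∈ C.σ, ∀ y' ∈ C.σ, |k x y - k x y'| ≤ a * (2 * e) * |y - y'| ^ γ)
    (h3 : ∀ x ∈ D.σ, ∀ x' ∈ D.σ, ∀ y ∈ C.σ, ∀ y' ∈ C.σ,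
      |k x y - k x' y - k x y' + k x' y'| ≤
        a * (2 * e) ^ 2 * (|x - x'| ^ γ * |y - y'| ^ γ)) :
    KernelBound θ γ (a * (1 + 2 * e) ^ 2 * M) (TwoChannel.smulKernel k F) := by
  have hsm : ∀ {V : Type _} [NormedAddCommGroup V] [NormedSpace ℂ V] {c s t : ℝ} {w : V},
      |c| ≤ s → ‖w‖ ≤ t → ‖(c : ℂ) • w‖ ≤ s * t := by
    intro V _ _ c s t w hc hw
    refine (norm_smul_le _ _).trans ?_
    rw [Complex.norm_real, Real.norm_eq_abs]
    exact mul_le_mul hc hw (norm_nonneg _) ((abs_nonneg _).trans hc)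
  have e1 : (1 : ℝ) ≤ (1 + 2 * e) ^ 2 := by nlinarith
  have e2 : 1 + 2 * e ≤ (1 + 2 * e) ^ 2 := by nlinarith
  constructor
  · intro x y
    have hx := Channel.wt_pos (C := D) (θ := θ) x
    have hy := Channel.wt_pos (C := C) (θ := θ) y
    refine (hsm (h0 _ (D.pos_mem x) _ (C.pos_mem y)) (hF.bound x y)).trans ?_
    have : 0 ≤ a * (M * D.wt θ x * C.wt θ y) := by positivity
    calc _ ≤ (a * (M * D.wt θ x * C.wt θ y)) * (1 + 2 * e) ^ 2 := le_mul_of_one_le_right this e1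
      _ = _ := by ring
  · intro x x' y
    have hy := Channel.wt_pos (C := C) (θ := θ) y
    have hx1 := Channel.wt_le_one (C := D) hθ (.inr x)
    have hx : (x : ℝ) ∈ D.σ := Or.inr x.2
    have hx' : (x' : ℝ) ∈ D.σ := Or.inr x'.2
    have hy' := C.pos_mem y
    have hb : ‖F.left x y‖ ≤ M * C.wt θ y := (hF.bound (.inr x) y).trans (by
      gcongr
      exact mul_le_of_le_one_right hM hx1)
    have key : (TwoChannel.smulKernel k F).left x y - (TwoChannel.smulKernel k F).left x' y =
        ((k x (C.pos y) - k x' (C.pos y) : ℝ) : ℂ) • F.left x y +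
          ((k x' (C.pos y) : ℝ) : ℂ) • (F.left x y - F.left x' y) := by
      change ((k x (C.pos y) : ℝ) : ℂ) • F.left x y - ((k x' (C.pos y) : ℝ) : ℂ) • F.left x' y = _
      push_cast
      module
    rw [key]
    refine (norm_add_le_of_le (hsm (h1 _ hx _ hx' _ hy') hb)
      (hsm (h0 _ hx' _ hy') (hF.left x x' y))).trans ?_
    have : 0 ≤ a * M * C.wt θ y * |(x : ℝ) - x'| ^ γ := by positivity
    calc _ = (a * M * C.wt θ y * |(x : ℝ) - x'| ^ γ) * (1 + 2 * e) := by ring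
      _ ≤ (a * M * C.wt θ y * |(x : ℝ) - x'| ^ γ) * (1 + 2 * e) ^ 2 := by gcongr
      _ = _ := by ring
  · intro x y y'
    have hxw := Channel.wt_pos (C := D) (θ := θ) x
    have hy1 := Channel.wt_le_one (C := C) hθ (.inr y)
    have hx := D.pos_mem x
    have hy : (y : ℝ) ∈ C.σ := Or.inr y.2
    have hy' : (y' : ℝ) ∈ C.σ := Or.inr y'.2
    have hb : ‖F.right x y‖ ≤ M * D.wt θ x := (hF.bound x (.inr y)).trans
      (mul_le_of_le_one_right (by positivity) hy1)
    have key : (TwoChannel.smulKernel k F).right x y - (TwoChannel.smulKernel k F).right x y' =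
        ((k (D.pos x) y - k (D.pos x) y' : ℝ) : ℂ) • F.right x y +
          ((k (D.pos x) y' : ℝ) : ℂ) • (F.right x y - F.right x y') := by
      change ((k (D.pos x) y : ℝ) : ℂ) • F.right x y -
        ((k (D.pos x) y' : ℝ) : ℂ) • F.right x y' = _
      push_cast
      module
    rw [key]
    refine (norm_add_le_of_le (hsm (h2 _ hx _ hy _ hy') hb)
      (hsm (h0 _ hx _ hy') (hF.right x y y'))).trans ?_
    have : 0 ≤ a * M * D.wt θ x * |(y : ℝ) - y'| ^ γ := by positivity
    calc _ = (a * M * D.wt θ x * |(y : ℝ) - y'| ^ γ) * (1 + 2 * e) := by ring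
      _ ≤ (a * M * D.wt θ x * |(y : ℝ) - y'| ^ γ) * (1 + 2 * e) ^ 2 := by gcongr
      _ = _ := by ring
  · intro x x' y y'
    have hx1 := Channel.wt_le_one (C := D) hθ (.inr x)
    have hy1 := Channel.wt_le_one (C := C) hθ (.inr y)
    have hx0 := Channel.wt_pos (C := D) (θ := θ) (.inr x)
    have hx : (x : ℝ) ∈ D.σ := Or.inr x.2
    have hx' : (x' : ℝ) ∈ D.σ := Or.inr x'.2
    have hy : (y : ℝ) ∈ C.σ := Or.inr y.2
    have hy' : (y' : ℝ) ∈ C.σ := Or.inr y'.2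
    have hb : ‖F.both x y‖ ≤ M := (hF.bound (.inr x) (.inr y)).trans
      ((mul_le_of_le_one_right (by positivity) hy1).trans (mul_le_of_le_one_right hM hx1))
    have hl : ‖F.both x y - F.both x' y‖ ≤ M * |(x : ℝ) - x'| ^ γ :=
      (hF.left x x' (.inr y)).trans (by
        gcongr
        exact mul_le_of_le_one_right hM hy1)
    have hr : ‖F.both x y - F.both x y'‖ ≤ M * |(y : ℝ) - y'| ^ γ :=
      (hF.right (.inr x) y y').trans (by
        gcongr
        exact mul_le_of_le_one_right hM hx1)
    -- Leibniz rule for the mixed difference: either difference may fall on `k` or on `F`, which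
    -- gives four terms.
    have key : (TwoChannel.smulKernel k F).both x y - (TwoChannel.smulKernel k F).both x' y -
        (TwoChannel.smulKernel k F).both x y' + (TwoChannel.smulKernel k F).both x' y' =
        ((k x y - k x' y - k x y' + k x' y' : ℝ) : ℂ) • F.both x y +
        ((k x' y - k x' y' : ℝ) : ℂ) • (F.both x y - F.both x' y) +
        ((k x y' - k x' y' : ℝ) : ℂ) • (F.both x y - F.both x y') +
        ((k x' y' : ℝ) : ℂ) • (F.both x y - F.both x' y - F.both x y' + F.both x' y') := by
      change ((k x y : ℝ) : ℂ) • F.both x y - ((k x' y : ℝ) : ℂ) • F.both x' y -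
        ((k x y' : ℝ) : ℂ) • F.both x y' + ((k x' y' : ℝ) : ℂ) • F.both x' y' = _
      push_cast
      module
    rw [key]
    refine (norm_add_le_of_le (norm_add_le_of_le (norm_add_le_of_le
      (hsm (h3 _ hx _ hx' _ hy _ hy') hb) (hsm (h2 _ hx' _ hy _ hy') hl))
      (hsm (h1 _ hx _ hx' _ hy') hr)) (hsm (h0 _ hx' _ hy') (hF.both x x' y y'))).trans_eq ?_
    ring

end Products

/-- Interpolates between a trivial bound and a Lipschitz bound to give a Hölder bound, both for `1 /
(y - x)` and for resolvents. -/
theorem min_one_le_rpow {t γ : ℝ} (ht : 0 ≤ t) (hγ₀ : 0 < γ) (hγ₁ : γ < 1) : min 1 t ≤ t ^ γ := by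
  rcases le_total 1 t with h | h
  · exact (min_le_left _ _).trans (Real.one_le_rpow h hγ₀.le)
  · refine (min_le_right _ _).trans ?_
    simpa using Real.rpow_le_rpow_of_exponent_ge' ht h hγ₀.le hγ₁.le

/-! ### Division by `y - x` across the spectral gap -/

section CauchyKernel

variable {d γ : ℝ}

theorem abs_inv_le {a : ℝ} (hd : 0 < d) (ha : d ≤ |a|) : |a⁻¹| ≤ 1 / d := by
  rw [abs_inv, one_div]
  exact inv_anti₀ hd ha

theorem div_rpow_eq {t : ℝ} (hd : 0 < d) (ht : 0 ≤ t) : (t / d) ^ γ = d ^ (-γ) * t ^ γ := by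
  rw [Real.div_rpow ht hd.le, Real.rpow_neg hd.le]
  ring

theorem abs_inv_sub_inv_le {a a' : ℝ} (hd : 0 < d) (hγ₀ : 0 < γ) (hγ₁ : γ < 1) (ha : d ≤ |a|)
    (ha' : d ≤ |a'|) : |a⁻¹ - a'⁻¹| ≤ 1 / d * (2 * d ^ (-γ)) * |a - a'| ^ γ := by
  have h1 := abs_inv_le hd ha
  have h2 := abs_inv_le hd ha'
  have hm := min_one_le_rpow (t := |a - a'| / d) (by positivity) hγ₀ hγ₁
  rw [div_rpow_eq hd (abs_nonneg _)] at hm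
  have hne : a ≠ 0 := abs_pos.1 (hd.trans_le ha)
  have hne' : a' ≠ 0 := abs_pos.1 (hd.trans_le ha')
  have key : |a⁻¹ - a'⁻¹| ≤ 2 / d * min 1 (|a - a'| / d) := by
    rw [mul_min_of_nonneg _ _ (by positivity)]
    refine le_min ?_ ?_
    · calc |a⁻¹ - a'⁻¹| ≤ |a⁻¹| + |a'⁻¹| := abs_sub _ _
        _ ≤ 1 / d + 1 / d := add_le_add h1 h2
        _ = 2 / d * 1 := by ring
    · have : a⁻¹ - a'⁻¹ = -(a - a') * (a⁻¹ * a'⁻¹) := by field_simp; ring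
      rw [this, abs_mul, abs_neg, abs_mul]
      calc _ ≤ |a - a'| * (1 / d * (1 / d)) := by gcongr
        _ ≤ |a - a'| * (1 / d * (1 / d)) * 2 := le_mul_of_one_le_right (by positivity) one_le_two
        _ = _ := by ring
  calc _ ≤ _ := key
    _ ≤ 2 / d * (d ^ (-γ) * |a - a'| ^ γ) := by gcongr
    _ = _ := by ring

/-- In each variable one may use the size of the kernel or its Lipschitz bound. The four
combinations give a product of two minima, and each minimum is then interpolated separately. -/
theorem abs_double_difference_le {x x' y y' : ℝ} (hd : 0 < d) (hγ₀ : 0 < γ) (hγ₁ : γ < 1)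
    (h₁ : d ≤ |y - x|) (h₂ : d ≤ |y - x'|) (h₃ : d ≤ |y' - x|) (h₄ : d ≤ |y' - x'|) :
    |(y - x)⁻¹ - (y - x')⁻¹ - (y' - x)⁻¹ + (y' - x')⁻¹| ≤
      1 / d * (2 * d ^ (-γ)) ^ 2 * (|x - x'| ^ γ * |y - y'| ^ γ) := by
  have n1 : y - x ≠ 0 := abs_pos.1 (hd.trans_le h₁)
  have n2 : y - x' ≠ 0 := abs_pos.1 (hd.trans_le h₂)
  have n3 : y' - x ≠ 0 := abs_pos.1 (hd.trans_le h₃)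
  have n4 : y' - x' ≠ 0 := abs_pos.1 (hd.trans_le h₄)
  have b1 := abs_inv_le hd h₁
  have b2 := abs_inv_le hd h₂
  have b3 := abs_inv_le hd h₃
  have b4 := abs_inv_le hd h₄
  have e1 : (y - x)⁻¹ - (y - x')⁻¹ = (x - x') * ((y - x)⁻¹ * (y - x')⁻¹) := by field_simp; ring
  have e2 : (y' - x)⁻¹ - (y' - x')⁻¹ = (x - x') * ((y' - x)⁻¹ * (y' - x')⁻¹) := by field_simp; ring
  have e3 : (y - x)⁻¹ - (y' - x)⁻¹ = -(y - y') * ((y - x)⁻¹ * (y' - x)⁻¹) := by field_simp; ring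
  have e4 : (y - x')⁻¹ - (y' - x')⁻¹ = -(y - y') * ((y - x')⁻¹ * (y' - x')⁻¹) := by
    field_simp; ring
  set p := (y - x)⁻¹
  set q := (y - x')⁻¹
  set r := (y' - x)⁻¹
  set w := (y' - x')⁻¹
  set s := |x - x'| with hs
  set t := |y - y'| with ht
  have hs0 : 0 ≤ s := abs_nonneg _
  have ht0 : 0 ≤ t := abs_nonneg _
  have hd' : 0 ≤ 1 / d := by positivity
  have c1 : |p - q - r + w| ≤ 4 / d * (1 * 1) := by
    calc |p - q - r + w| ≤ |p| + |q| + |r| + |w| :=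
          (abs_add_le _ _).trans (add_le_add_left ((abs_sub _ _).trans
            (add_le_add_left (abs_sub _ _) _)) _)
      _ ≤ 1 / d + 1 / d + 1 / d + 1 / d := by gcongr
      _ = _ := by ring
  have c2 : |p - q - r + w| ≤ 4 / d * (s / d * 1) := by
    have h : p - q - r + w = (x - x') * (p * q - r * w) := by linear_combination e1 - e2
    rw [h, abs_mul]
    calc _ ≤ s * (|p * q| + |r * w|) := mul_le_mul_of_nonneg_left (abs_sub _ _) hs0
      _ = s * (|p| * |q| + |r| * |w|) := by rw [abs_mul, abs_mul]
      _ ≤ s * (1 / d * (1 / d) + 1 / d * (1 / d)) := by gcongr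
      _ ≤ s * (1 / d * (1 / d) + 1 / d * (1 / d)) * 2 :=
          le_mul_of_one_le_right (by positivity) one_le_two
      _ = _ := by ring
  have c3 : |p - q - r + w| ≤ 4 / d * (1 * (t / d)) := by
    have h : p - q - r + w = (y - y') * (q * w - p * r) := by linear_combination e3 - e4
    rw [h, abs_mul]
    calc _ ≤ t * (|q * w| + |p * r|) := mul_le_mul_of_nonneg_left (abs_sub _ _) ht0
      _ = t * (|q| * |w| + |p| * |r|) := by rw [abs_mul, abs_mul]
      _ ≤ t * (1 / d * (1 / d) + 1 / d * (1 / d)) := by gcongr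
      _ ≤ t * (1 / d * (1 / d) + 1 / d * (1 / d)) * 2 :=
          le_mul_of_one_le_right (by positivity) one_le_two
      _ = _ := by ring
  have c4 : |p - q - r + w| ≤ 4 / d * (s / d * (t / d)) := by
    -- Both increments are extracted: `p q - r w = p (q - w) + w (p - r)`, and each bracket contains
    -- a factor `-(y - y')`.
    have h : p - q - r + w = (x - x') * (-(y - y') * (p * w * (q + r))) := by
      linear_combination e1 - e2 + (x - x') * (p * e4 + w * e3)
    rw [h, abs_mul, abs_mul, abs_mul, abs_mul, abs_neg]
    calc _ ≤ s * (t * (1 / d * (1 / d) * (1 / d + 1 / d))) := by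
          gcongr
          exact (abs_add_le _ _).trans (add_le_add b2 b3)
      _ ≤ s * (t * (1 / d * (1 / d) * (1 / d + 1 / d))) * 2 :=
          le_mul_of_one_le_right (by positivity) one_le_two
      _ = _ := by ring
  have key : |p - q - r + w| ≤ 4 / d * (min 1 (s / d) * min 1 (t / d)) := by
    rcases min_choice 1 (s / d) with h | h <;> rcases min_choice 1 (t / d) with h' | h' <;>
      rw [h, h'] <;> assumption
  have m1 := min_one_le_rpow (t := s / d) (by positivity) hγ₀ hγ₁
  have m2 := min_one_le_rpow (t := t / d) (by positivity) hγ₀ hγ₁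
  rw [div_rpow_eq hd hs0] at m1
  rw [div_rpow_eq hd ht0] at m2
  calc _ ≤ _ := key
    _ ≤ 4 / d * ((d ^ (-γ) * s ^ γ) * (d ^ (-γ) * t ^ γ)) := by gcongr
    _ = _ := by ring

theorem KernelBound.cauchy {D : Channel.{v}} {C : Channel.{u}} {θ M : ℝ} {F : OpKernel D C}
    (hF : KernelBound θ γ M F) (hθ : 0 ≤ θ) (hM : 0 ≤ M) (hd : 0 < d) (hγ₀ : 0 < γ) (hγ₁ : γ < 1)
    (hdist : ∀ l ∈ C.σ, ∀ m ∈ D.σ, d ≤ |l - m|) :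
    KernelBound θ γ (1 / d * (1 + 2 * d ^ (-γ)) ^ 2 * M)
      (TwoChannel.smulKernel (fun x y => (y - x)⁻¹) F) := by
  refine hF.smulKernel hθ hM (by positivity) (by positivity) (fun x hx y hy => ?_)
    (fun x hx x' hx' y hy => ?_) (fun x hx y hy y' hy' => ?_) (fun x hx x' hx' y hy y' hy' => ?_)
  · exact abs_inv_le hd (hdist y hy x hx)
  · refine (abs_inv_sub_inv_le hd hγ₀ hγ₁ (hdist y hy x hx) (hdist y hy x' hx')).trans_eq ?_
    rw [sub_sub_sub_cancel_left, abs_sub_comm]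
  · refine (abs_inv_sub_inv_le hd hγ₀ hγ₁ (hdist y hy x hx) (hdist y' hy' x hx)).trans_eq ?_
    rw [sub_sub_sub_cancel_right]
  · exact abs_double_difference_le hd hγ₀ hγ₁ (hdist y hy x hx) (hdist y hy x' hx')
      (hdist y' hy' x hx) (hdist y' hy' x' hx')

end CauchyKernel

/-! ### Resolvents of the perturbed operator -/

namespace Channel

variable {C : Channel.{u}}

theorem IsResolventAt.sub_eq {W R R' : C.H →L[ℂ] C.H} {z z' : ℂ} (h : C.IsResolventAt W z R)
    (h' : C.IsResolventAt W z' R') : R - R' = (z - z') • R ∘L R' := by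
  ext1 g
  have h1 := h.apply (h'.graph g)
  rw [show g - W (R' g) + z' • R' g + W (R' g) - z • R' g = g - (z - z') • R' g by module,
    map_sub, map_smul] at h1
  change R g - R' g = (z - z') • R (R' g)
  exact sub_eq_of_eq_add' (sub_eq_iff_eq_add.1 h1)

/-- The trivial bound `2K` is interpolated with the bound `K² |x - x'|` from the resolvent identity.
This is the source of the factors `K (1 + K^γ)` in the result. -/
theorem IsResolventAt.norm_sub_le {W R R' : C.H →L[ℂ] C.H} {x x' K γ : ℝ}
    (h : C.IsResolventAt W (x : ℂ) R) (h' : C.IsResolventAt W (x' : ℂ) R') (hγ₀ : 0 < γ)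
    (hγ₁ : γ < 1) (hR : ‖R‖ ≤ K) (hR' : ‖R'‖ ≤ K) :
    ‖R - R'‖ ≤ 2 * K * K ^ γ * |x - x'| ^ γ := by
  have hK : 0 ≤ K := (norm_nonneg _).trans hR
  have hm := min_one_le_rpow (t := K * |x - x'|) (by positivity) hγ₀ hγ₁
  rw [Real.mul_rpow hK (abs_nonneg _)] at hm
  have key : ‖R - R'‖ ≤ 2 * K * min 1 (K * |x - x'|) := by
    rw [mul_min_of_nonneg _ _ (by positivity)]
    refine le_min ?_ ?_
    · exact (_root_.norm_sub_le _ _).trans (by linarith)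
    · rw [h.sub_eq h', norm_smul, ← Complex.ofReal_sub, Complex.norm_real, Real.norm_eq_abs]
      calc |x - x'| * ‖R ∘L R'‖ ≤ |x - x'| * (K * K) := by
            gcongr
            exact (ContinuousLinearMap.opNorm_comp_le _ _).trans
              (mul_le_mul hR hR' (norm_nonneg _) hK)
        _ ≤ |x - x'| * (K * K) * 2 := le_mul_of_one_le_right (by positivity) one_le_two
        _ = _ := by ring
  calc _ ≤ _ := key
    _ ≤ 2 * K * (K ^ γ * |x - x'| ^ γ) := by gcongr
    _ = _ := by ring

/-- Neumann series: with `S = (A - z)⁻¹` one has `A + W - z = (1 + W S)(A - z)`, and `‖W S‖ < 1`.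
The resolvent is `S (1 + W S)⁻¹`. -/
theorem exists_resolvent {W : C.H →L[ℂ] C.H} {z : ℂ} {d : ℝ}
    (hz : ∀ x, d ≤ ‖(C.pos x : ℂ) - z‖) (hW : ‖W‖ < d) : ∃ R, C.IsResolventAt W z R := by
  have hd : 0 < d := (norm_nonneg _).trans_lt hW
  obtain ⟨S, hS, -, hSg, hSi⟩ := exists_free_resolvent hd hz
  have hlt : ‖-(W ∘L S)‖ < 1 := by
    rw [norm_neg]
    calc ‖W ∘L S‖ ≤ ‖W‖ * ‖S‖ := ContinuousLinearMap.opNorm_comp_le _ _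
      _ ≤ ‖W‖ * (1 / d) := by gcongr
      _ < 1 := by rwa [mul_one_div, div_lt_one hd]
  let V : (C.H →L[ℂ] C.H)ˣ := Units.oneSub (-(W ∘L S)) hlt
  let V' : C.H →L[ℂ] C.H := ↑V⁻¹
  have hV : ∀ g, V' g + W (S (V' g)) = g := fun g => by
    have h1 : (V : C.H →L[ℂ] C.H) * V' = 1 := V.mul_inv
    have h2 := DFunLike.congr_fun h1 g
    rw [Units.val_oneSub, sub_neg_eq_add] at h2
    exact h2
  have hV2 : ∀ g, V' (g + W (S g)) = g := fun g => by
    have h1 : V' * (V : C.H →L[ℂ] C.H) = 1 := V.inv_mul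
    have h2 := DFunLike.congr_fun h1 g
    rw [Units.val_oneSub, sub_neg_eq_add] at h2
    exact h2
  refine ⟨S ∘L V', isResolventAt_of_graph (fun g => ?_) fun f k hfk => ?_⟩
  · have h1 := hSg (V' g)
    have h2 : g - W ((S ∘L V') g) + z • (S ∘L V') g = V' g + z • S (V' g) := by
      change g - W (S (V' g)) + z • S (V' g) = _
      nth_rewrite 1 [← hV g]
      abel
    rw [h2]
    exact h1
  · have h1 := hSi f k hfk
    change S (V' (k + W f - z • f)) = f
    have h2 : k + W f - z • f = (k - z • f) + W (S (k - z • f)) := by rw [h1]; abel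
    rw [h2, hV2, h1]

/-- From `R g = S (g - W R g)` with `‖S‖ ≤ 1/d`, the term `‖W‖ ‖R g‖` is absorbed on the left. -/
theorem IsResolventAt.norm_le {W R : C.H →L[ℂ] C.H} {z : ℂ} {d : ℝ} (h : C.IsResolventAt W z R)
    (hz : ∀ x, d ≤ ‖(C.pos x : ℂ) - z‖) (hW : ‖W‖ < d) : ‖R‖ ≤ 1 / (d - ‖W‖) := by
  have hd : 0 < d := (norm_nonneg _).trans_lt hW
  have hdW : 0 < d - ‖W‖ := sub_pos.2 hW
  obtain ⟨S, hS, -, -, hSi⟩ := exists_free_resolvent hd hz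
  refine ContinuousLinearMap.opNorm_le_bound _ (by positivity) fun g => ?_
  have h1 := hSi _ _ (h.graph g)
  rw [add_sub_cancel_right] at h1
  have h2 : ‖R g‖ ≤ 1 / d * (‖g‖ + ‖W‖ * ‖R g‖) := by
    nth_rewrite 1 [← h1]
    refine (S.le_of_opNorm_le hS _).trans ?_
    gcongr
    exact (_root_.norm_sub_le _ _).trans (by gcongr; exact W.le_opNorm _)
  rw [one_div_mul_eq_div, le_div_iff₀ hd] at h2
  rw [one_div_mul_eq_div, le_div_iff₀ hdW]
  linarith

theorem Graph.inner_eq {f k g l : C.H} (hf : Graph f k) (hg : Graph g l) :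
    inner ℂ k g = inner ℂ f l := by
  rw [inner_eq_integral, inner_eq_integral]
  refine integral_congr_ae ?_
  filter_upwards [hf, hg] with x h1 h2
  rw [h1, h2, inner_smul_left, inner_smul_right, Complex.conj_ofReal]

end Channel

theorem IsHolderFamily.neg {C : Channel.{u}} {H' : Type*} [NormedAddCommGroup H'] [NormedSpace ℂ H']
    {θ γ M : ℝ} {X : (x : C.Pt) → H' →L[ℂ] C.Fib x} (hX : IsHolderFamily θ γ M X) :
    IsHolderFamily θ γ M fun x => -X x where
  bound x := (norm_neg _).trans_le (hX.bound x)
  holder x x' := by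
    refine le_trans (le_of_eq ?_) (hX.holder x x')
    refine Eq.trans (congrArg norm ?_) (norm_neg _)
    exact (neg_sub_neg (contRange X x) (contRange X x')).trans (neg_sub _ _).symm

theorem IsHolderFamily.comp_const {C : Channel.{u}} {H' H'' : Type*} [NormedAddCommGroup H']
    [NormedSpace ℂ H'] [NormedAddCommGroup H''] [NormedSpace ℂ H'']
    {θ γ M : ℝ} {X : (x : C.Pt) → H' →L[ℂ] C.Fib x} (hX : IsHolderFamily θ γ M X)
    (T : H'' →L[ℂ] H') {a : ℝ} (hT : ‖T‖ ≤ a) (hM : 0 ≤ M) :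
    IsHolderFamily θ γ (M * a) fun x => X x ∘L T where
  bound x := by
    refine (ContinuousLinearMap.opNorm_comp_le _ _).trans ((mul_le_mul (hX.bound x) hT
      (norm_nonneg _) (mul_nonneg hM (Channel.wt_pos x).le)).trans_eq (by ring))
  holder x x' := by
    refine le_trans (le_of_eq ?_) ((ContinuousLinearMap.opNorm_comp_le
      (contRange X x - contRange X x') T).trans
      ((mul_le_mul (hX.holder x x') hT (norm_nonneg _) (by positivity)).trans_eq (by ring)))
    exact congrArg norm (ContinuousLinearMap.sub_comp _ _ _).symm

/-- Here the resolvent is taken at the base point itself. The increment splits into one of `X` times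
a bounded resolvent and one of the resolvent times a bounded `X`, giving `K + 2 K K^γ ≤ 2 K (1 +
K^γ)`. -/
theorem IsHolderFamily.comp_resolvent {D : Channel.{v}} {C : Channel.{u}} {θ γ M K : ℝ}
    {X : (x : D.Pt) → C.H →L[ℂ] D.Fib x} (hX : IsHolderFamily θ γ M X) (hθ : 0 ≤ θ) (hM : 0 ≤ M)
    (hK : 0 ≤ K) (hγ₀ : 0 < γ) (hγ₁ : γ < 1) {W : C.H →L[ℂ] C.H} {R : ℝ → C.H →L[ℂ] C.H}
    (hR : ∀ m ∈ D.σ, C.IsResolventAt W (m : ℂ) (R m)) (hRn : ∀ m ∈ D.σ, ‖R m‖ ≤ K) :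
    IsHolderFamily θ γ (M * (2 * (K * (1 + K ^ γ)))) fun x => X x ∘L R (D.pos x) := by
  have hKγ : 0 ≤ K ^ γ := Real.rpow_nonneg hK γ
  constructor
  · intro x
    have hw := Channel.wt_pos (C := D) (θ := θ) x
    refine (ContinuousLinearMap.opNorm_comp_le _ _).trans ((mul_le_mul (hX.bound x)
      (hRn _ (D.pos_mem x)) (norm_nonneg _) (by positivity)).trans ?_)
    have : 0 ≤ M * D.wt θ x * (K + 2 * K * K ^ γ) := by positivity
    linarith
  · intro x x'
    have hx : (x : ℝ) ∈ D.σ := Or.inr x.2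
    have hx' : (x' : ℝ) ∈ D.σ := Or.inr x'.2
    have hb : ‖contRange X x'‖ ≤ M := (hX.bound (.inr x')).trans
      (mul_le_of_le_one_right hM (Channel.wt_le_one hθ _))
    have hd := (hR x hx).norm_sub_le (hR x' hx') hγ₀ hγ₁ (hRn x hx) (hRn x' hx')
    have key : contRange (fun x => X x ∘L R (D.pos x)) x -
        contRange (fun x => X x ∘L R (D.pos x)) x' =
        (contRange X x - contRange X x') ∘L R x + contRange X x' ∘L (R x - R x') := by
      rw [ContinuousLinearMap.sub_comp, ContinuousLinearMap.comp_sub, sub_add_sub_cancel]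
      rfl
    rw [key]
    refine (norm_add_le_of_le
      ((ContinuousLinearMap.opNorm_comp_le _ _).trans (mul_le_mul (hX.holder x x') (hRn x hx)
        (norm_nonneg _) (by positivity)))
      ((ContinuousLinearMap.opNorm_comp_le _ _).trans (mul_le_mul hb hd
        (norm_nonneg _) hM))).trans ?_
    have : 0 ≤ M * |(x : ℝ) - x'| ^ γ * K := by positivity
    linarith

open Filter Topology

/-! ### Pointwise form of the basic equation, the Riccati equation and its dual -/

section Spectral

variable {D : Channel.{v}} {C : Channel.{u}} {θ γ M : ℝ}

theorem comp_neg_apply {U V W : Type*} [NormedAddCommGroup U] [NormedSpace ℂ U]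
    [NormedAddCommGroup V] [NormedSpace ℂ V] [NormedAddCommGroup W] [NormedSpace ℂ W]
    (S : V →L[ℂ] W) (T : U →L[ℂ] V) (h : U) : (S ∘L (-T)) h = -S (T h) := by
  simp

theorem Channel.eval_sum {ι : Type*} (s : Finset ι) (f : ι → C.H) :
    ∀ᵐ x ∂C.meas, C.eval (∑ i ∈ s, f i) x = ∑ i ∈ s, C.eval (f i) x := by
  classical
  induction s using Finset.induction_on with
  | empty => simpa using C.eval_zero
  | insert a s ha ih =>
    filter_upwards [ih, C.eval_add (f a) (∑ i ∈ s, f i)] with x h1 h2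
    rw [Finset.sum_insert ha, Finset.sum_insert ha, h2, h1]

/-- The fibres of a simple function partition the line, so at a given point exactly one spectral
projection survives. -/
theorem eval_spectralSum {B : C.H →L[ℂ] D.H} {X : (x : D.Pt) → C.H →L[ℂ] D.Fib x}
    (hB : ∀ f, ∀ᵐ x ∂D.meas, D.eval (B f) x = X x f) (T : SimpleFunc ℝ (C.H →L[ℂ] C.H))
    (f : C.H) : ∀ᵐ x ∂D.meas, D.eval (spectralSum D C B T f) x = X x (T (D.pos x) f) := by
  have h1 : ∀ᵐ x ∂D.meas, ∀ Y ∈ T.range,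
      D.eval (D.E (T ⁻¹' {Y}) (T.measurableSet_fiber Y) (B (Y f))) x =
        open Classical in if T (D.pos x) = Y then X x (Y f) else 0 := by
    refine (Filter.eventually_all_finset _).2 fun Y _ => ?_
    filter_upwards [Channel.eval_E (T ⁻¹' {Y}) (T.measurableSet_fiber Y) (B (Y f)), hB (Y f)]
      with x h2 h3
    by_cases hx : T (D.pos x) = Y
    · rw [if_pos hx, h2.1 hx, h3]
    · rw [if_neg hx, h2.2 hx]
  have h4 : spectralSum D C B T f =
      ∑ Y ∈ T.range, D.E (T ⁻¹' {Y}) (T.measurableSet_fiber Y) (B (Y f)) := by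
    simp [spectralSum]
  rw [h4]
  filter_upwards [h1, Channel.eval_sum T.range
    fun Y => D.E (T ⁻¹' {Y}) (T.measurableSet_fiber Y) (B (Y f))] with x h2 h3
  rw [h3, Finset.sum_congr rfl h2, Finset.sum_eq_single (T (D.pos x)) ?_ ?_, if_pos rfl]
  · exact fun Y _ hY => if_neg (Ne.symm hY)
  · exact fun h => absurd (T.mem_range_self _) h

/-- The integral sums converge to `Q` in norm, and their values at almost every `x` converge to
`X(x) R(x) f`; the two limits agree. -/
theorem eval_spectralIntegral {B Q : C.H →L[ℂ] D.H} {R : ℝ → C.H →L[ℂ] C.H} (hθ : 1 / 2 < θ)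
    (hM : 0 ≤ M) {X : (x : D.Pt) → C.H →L[ℂ] D.Fib x} (hX : IsHolderFamily θ γ M X)
    (hB : ∀ f, ∀ᵐ x ∂D.meas, D.eval (B f) x = X x f) (hQ : HasSpectralIntegral D C B R Q)
    (f : C.H) : ∀ᵐ x ∂D.meas, D.eval (Q f) x = X x (R (D.pos x) f) := by
  have hε : ∀ n : ℕ, (0 : ℝ) < 1 / (n + 1) := fun n => by positivity
  choose δ hδ hS using fun n : ℕ => hQ.2 _ (hε n)
  -- The first term of the minimum controls the integral sums in norm, the second their values at
  -- single points.
  choose T hT using fun n : ℕ => hQ.1 _ (lt_min (hδ n) (hε n))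
  have hclose : ∀ n, ‖spectralSum D C B (T n) - Q‖ ≤ 1 / (n + 1) := fun n => by
    obtain ⟨S, hSm, h0, h1⟩ := hT n
    exact hS n _ ⟨S, hSm, h0, fun μ hμ => (h1 μ hμ).trans (min_le_left _ _)⟩
  have hlim : Tendsto (fun n => spectralSum D C B (T n) f) atTop (𝓝 (Q f)) := by
    refine tendsto_iff_norm_sub_tendsto_zero.2 ?_
    have h1 : Tendsto (fun n : ℕ => 1 / ((n : ℝ) + 1) * ‖f‖) atTop (𝓝 0) := by
      simpa using tendsto_one_div_add_atTop_nhds_zero_nat.mul_const ‖f‖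
    refine squeeze_zero (fun _ => norm_nonneg _) (fun n => ?_) h1
    exact (spectralSum D C B (T n) - Q).le_of_opNorm_le (hclose n) f
  refine Channel.ae_eval_eq_of_tendsto hlim ?_
  have hpt : ∀ᵐ x ∂D.meas, ∀ n,
      ‖D.eval (spectralSum D C B (T n) f) x - X x (R (D.pos x) f)‖ ≤
        M * (1 / (n + 1) * ‖f‖) := by
    refine ae_all_iff.2 fun n => ?_
    obtain ⟨S, hSm, h0, h1⟩ := hT n
    filter_upwards [eval_spectralSum hB (T n) f, Channel.ae_notMem_or_subsingleton hθ hSm h0]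
      with x h2 h3
    rcases h3 with h3 | h3
    · rw [h2, ← map_sub]
      have hd := (h1 _ ⟨D.pos_mem x, h3⟩).trans (min_le_right _ _)
      have hb : ‖X x‖ ≤ M := (hX.bound x).trans
        (mul_le_of_le_one_right hM (Channel.wt_le_one (by linarith) _))
      refine ((X x).le_of_opNorm_le hb _).trans ?_
      gcongr
      exact (T n (D.pos x) - R (D.pos x)).le_of_opNorm_le hd f
    · rw [h3 (_ - _), norm_zero]
      positivity
  filter_upwards [hpt] with x hx
  refine tendsto_iff_norm_sub_tendsto_zero.2 (squeeze_zero (fun _ => norm_nonneg _) hx ?_)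
  simpa using (tendsto_one_div_add_atTop_nhds_zero_nat.mul_const ‖f‖).const_mul M

/-- The Riccati equation `Q A - A Q + Q B* Q = B` on the domain of `A`. -/
theorem graph_riccati {B Q : C.H →L[ℂ] D.H} {R : ℝ → C.H →L[ℂ] C.H}
    {X : (x : D.Pt) → C.H →L[ℂ] D.Fib x} (hB : ∀ f, ∀ᵐ x ∂D.meas, D.eval (B f) x = X x f)
    (hR : ∀ m ∈ D.σ, C.IsResolventAt (B.adjoint ∘L Q) (m : ℂ) (R m))
    (hQ : ∀ f, ∀ᵐ x ∂D.meas, D.eval (Q f) x = X x (R (D.pos x) f)) {f k : C.H}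
    (hfk : Channel.Graph f k) : Channel.Graph (Q f) (Q (k + B.adjoint (Q f)) - B f) := by
  filter_upwards [hQ f, hQ (k + B.adjoint (Q f)), hB f,
    D.eval_sub (Q (k + B.adjoint (Q f))) (B f)] with x h1 h2 h3 h4
  -- At spectral parameter `x` this reads `R(x) (A f + B*Q f) - x R(x) f = f`; applying the row
  -- `X(x)` gives the Riccati equation at the point `x`.
  have h5 := (hR _ (D.pos_mem x)).apply hfk
  rw [map_sub, map_smul, sub_eq_iff_eq_add] at h5
  rw [h4, h2, h3, h1]
  have h6 : R (D.pos x) (k + B.adjoint (Q f)) = f + (D.pos x : ℂ) • R (D.pos x) f := h5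
  rw [h6, map_add, map_smul, add_sub_cancel_left]

/-- The Riccati equation is paired with `h` in the domain of `A_D`. Self-adjointness of `A_C`,
through `graph_of_inner_eq`, shows that `Q* h` lies in its domain, which is not assumed. -/
theorem graph_riccati_adjoint {B Q : C.H →L[ℂ] D.H}
    (hQ : ∀ f k : C.H, Channel.Graph f k →
      Channel.Graph (Q f) (Q (k + B.adjoint (Q f)) - B f)) {h l : D.H}
    (hl : Channel.Graph h l) :
    Channel.Graph (Q.adjoint h) (Q.adjoint (l - B (Q.adjoint h)) + B.adjoint h) := by
  refine Channel.graph_of_inner_eq fun f k hfk => ?_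
  have h1 := (hQ f k hfk).inner_eq hl
  rw [inner_sub_left, map_add, inner_add_left] at h1
  rw [inner_add_right, ContinuousLinearMap.adjoint_inner_right,
    ContinuousLinearMap.adjoint_inner_right, ContinuousLinearMap.adjoint_inner_right,
    inner_sub_right, ← h1, ← ContinuousLinearMap.adjoint_inner_right Q (B.adjoint (Q f)) h,
    ContinuousLinearMap.adjoint_inner_left]
  ring

/-- The hypothesis is `Z = (A - l) Z S(l)` for every `l` in the spectrum. On a cell of length `ε`
containing such an `l`, the factor `A - l` has norm at most `ε`, so the localised operator satisfies
`‖P Z‖ ≤ ε K ‖P Z‖` and vanishes once `ε K < 1`. Countably many cells cover the line, and those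
without spectrum are irrelevant. -/
theorem eq_zero_of_diagonal {H' : Type*} [NormedAddCommGroup H'] [NormedSpace ℂ H']
    {Z : H' →L[ℂ] C.H} {S : ℝ → H' →L[ℂ] H'} {K : ℝ} (hK : 0 ≤ K) (hSK : ∀ l ∈ C.σ, ‖S l‖ ≤ K)
    (hdiag : ∀ l ∈ C.σ, ∀ g, ∀ᵐ y ∂C.meas,
      C.eval (Z g) y = ((C.pos y : ℂ) - l) • C.eval (Z (S l g)) y) : Z = 0 := by
  obtain ⟨ε, hε, hεK⟩ : ∃ ε : ℝ, 0 < ε ∧ ε * K ≤ 1 / 2 := by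
    refine ⟨1 / (2 * (K + 1)), by positivity, ?_⟩
    rw [one_div_mul_eq_div, div_le_div_iff₀ (by positivity) two_pos]
    linarith
  have hcell : ∀ n : ℤ, ∀ g, ∀ᵐ y ∂C.meas, C.pos y ∈ Set.Ico (n * ε) ((n + 1) * ε) →
      C.eval (Z g) y = 0 := by
    intro n g
    by_cases hex : ∃ l ∈ C.σ, l ∈ Set.Ico (n * ε) ((n + 1) * ε)
    · obtain ⟨l, hl, hln⟩ := hex
      obtain ⟨P, hP⟩ : ∃ P : C.H →L[ℂ] C.H, ∀ f, ∀ᵐ x ∂C.meas,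
          (C.pos x ∈ Set.Ico (n * ε) ((n + 1) * ε) → C.eval (P f) x = C.eval f x) ∧
          (C.pos x ∉ Set.Ico (n * ε) ((n + 1) * ε) → C.eval (P f) x = 0) :=
        ⟨_, Channel.eval_E _ measurableSet_Ico⟩
      have hle : ‖P ∘L Z‖ ≤ 1 / 2 * ‖P ∘L Z‖ := by
        refine ContinuousLinearMap.opNorm_le_bound _ (by positivity) fun g => ?_
        have h1 : ‖P (Z g)‖ ≤ ε * ‖P (Z (S l g))‖ := by
          refine Channel.norm_le_mul_of_ae_le hε.le ?_
          filter_upwards [hdiag l hl g, hP (Z g), hP (Z (S l g))] with y h2 h3 h4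
          by_cases hy : C.pos y ∈ Set.Ico (n * ε) ((n + 1) * ε)
          · rw [h3.1 hy, h4.1 hy, h2, norm_smul, ← Complex.ofReal_sub, Complex.norm_real,
              Real.norm_eq_abs]
            gcongr
            rw [abs_le]
            constructor <;> linarith [hy.1, hy.2, hln.1, hln.2]
          · rw [h3.2 hy, norm_zero]
            positivity
        calc ‖P (Z g)‖ ≤ ε * ‖P (Z (S l g))‖ := h1
          _ ≤ ε * (‖P ∘L Z‖ * (K * ‖g‖)) := by
              gcongr
              refine ((P ∘L Z).le_opNorm (S l g)).trans ?_
              gcongr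
              exact (S l).le_of_opNorm_le (hSK l hl) g
          _ = (ε * K) * (‖P ∘L Z‖ * ‖g‖) := by ring
          _ ≤ 1 / 2 * (‖P ∘L Z‖ * ‖g‖) := by gcongr
          _ = _ := by ring
      have hle0 : ‖P ∘L Z‖ ≤ 0 := by linarith
      have h1 : P (Z g) = 0 := norm_le_zero_iff.1 (((P ∘L Z).le_opNorm g).trans
        (mul_nonpos_of_nonpos_of_nonneg hle0 (norm_nonneg g)))
      filter_upwards [hP (Z g), C.eval_zero] with y h3 h4 hy
      rw [← h3.1 hy, h1, h4]
    · refine Filter.Eventually.of_forall fun y hy => ?_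
      exact absurd ⟨C.pos y, C.pos_mem y, hy⟩ hex
  ext1 h
  refine Channel.ext_eval ?_
  filter_upwards [ae_all_iff.2 fun n => hcell n h, C.eval_zero] with y h1 h2
  refine Eq.trans ?_ h2.symm
  refine h1 ⌊C.pos y / ε⌋ ⟨?_, ?_⟩
  · exact (le_div_iff₀ hε).1 (Int.floor_le _)
  · exact (div_lt_iff₀ hε).1 (Int.lt_floor_add_one _)

/-- `Q*` and the candidate `T` solve the same inhomogeneous equation, so `B* h` cancels and the
difference intertwines `A_D - B Q*` with `A_C`. -/
theorem graph_sub_of_riccati_adjoint {B Q : C.H →L[ℂ] D.H} {T : D.H →L[ℂ] C.H}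
    {S : ℝ → D.H →L[ℂ] D.H} {Y : (y : C.Pt) → D.H →L[ℂ] C.Fib y}
    (hB : ∀ h, ∀ᵐ y ∂C.meas, C.eval (B.adjoint h) y = Y y h)
    (hT : ∀ h, ∀ᵐ y ∂C.meas, C.eval (T h) y = (-(Y y ∘L S (C.pos y))) h)
    (hS : ∀ l ∈ C.σ, D.IsResolventAt (B ∘L (-Q.adjoint)) (l : ℂ) (S l)) {h l : D.H}
    (hl : Channel.Graph h l) (hQ : Channel.Graph (Q.adjoint h)
      (Q.adjoint (l - B (Q.adjoint h)) + B.adjoint h)) :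
    Channel.Graph ((Q.adjoint - T) h) ((Q.adjoint - T) (l - B (Q.adjoint h))) := by
  set k := l - B (Q.adjoint h) with hk
  have h14 : ∀ g, (Q.adjoint - T) g = Q.adjoint g - T g := fun g => rfl
  rw [h14, h14]
  filter_upwards [hQ, hT h, hT k, hB h, C.eval_add (Q.adjoint k) (B.adjoint h),
    C.eval_sub (Q.adjoint h) (T h), C.eval_sub (Q.adjoint k) (T k)]
    with y h1 h2 h3 h4 h5 h6 h7
  have h8 := (hS _ (C.pos_mem y)).apply hl
  rw [comp_neg_apply, ← sub_eq_add_neg, ← hk, map_sub, map_smul, sub_eq_iff_eq_add] at h8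
  have h10 : (-(Y y ∘L S (C.pos y))) k = -(Y y (S (C.pos y) k)) := rfl
  have h11 : (-(Y y ∘L S (C.pos y))) h = -(Y y (S (C.pos y) h)) := rfl
  rw [h8, map_add, map_smul] at h10
  rw [h7, h6, h3, h10, h2, h11, smul_sub, ← h1, h5, h4]
  module

/-- An intertwining `A Z = Z (A_D + W)` composed with the resolvent at `l` becomes `(A - l) Z R =
Z`, the form required by `eq_zero_of_diagonal`. -/
theorem diagonal_of_graph {W : D.H →L[ℂ] D.H} {Z : D.H →L[ℂ] C.H} {R : D.H →L[ℂ] D.H} {l : ℝ}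
    (hR : D.IsResolventAt W (l : ℂ) R)
    (hZ : ∀ h k, Channel.Graph h k → Channel.Graph (Z h) (Z (k + W h))) (g : D.H) :
    ∀ᵐ y ∂C.meas, C.eval (Z g) y = ((C.pos y : ℂ) - l) • C.eval (Z (R g)) y := by
  have h1 := hZ _ _ (hR.graph g)
  rw [add_right_comm, sub_add_cancel, map_add, map_smul] at h1
  filter_upwards [h1, C.eval_add (Z g) ((l : ℂ) • Z (R g)), C.eval_smul (l : ℂ) (Z (R g))]
    with y h2 h3 h4
  rw [h3, h4] at h2
  rw [sub_smul, ← h2, add_sub_cancel_right]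

/-- The dual representation `(Q* h)(λ) = -B*(λ, ·) (A - B Q* - λ)⁻¹ h`. -/
theorem eval_adjoint {B Q : C.H →L[ℂ] D.H} {S : ℝ → D.H →L[ℂ] D.H} {K : ℝ} (hθ : 1 / 2 < θ)
    (hγ₀ : 0 < γ) (hM : 0 ≤ M) (hQ : ∀ f k : C.H, Channel.Graph f k →
      Channel.Graph (Q f) (Q (k + B.adjoint (Q f)) - B f))
    {Y : (y : C.Pt) → D.H →L[ℂ] C.Fib y}
    (hB : ∀ h, ∀ᵐ y ∂C.meas, C.eval (B.adjoint h) y = Y y h)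
    (hY : IsHolderFamily θ γ M fun y => -(Y y ∘L S (C.pos y))) (hK : 0 ≤ K)
    (hS : ∀ l ∈ C.σ, D.IsResolventAt (B ∘L (-Q.adjoint)) (l : ℂ) (S l))
    (hSK : ∀ l ∈ C.σ, ‖S l‖ ≤ K) (h : D.H) :
    ∀ᵐ y ∂C.meas, C.eval (Q.adjoint h) y = (-(Y y ∘L S (C.pos y))) h := by
  obtain ⟨T, hT⟩ := hY.exists_clm hθ hγ₀ hM
  have hZ : Q.adjoint - T = 0 := by
    refine eq_zero_of_diagonal hK hSK fun l hl g => ?_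
    refine diagonal_of_graph (hS l hl) (fun f k hfk => ?_) g
    rw [comp_neg_apply, ← sub_eq_add_neg]
    exact graph_sub_of_riccati_adjoint hB hT hS hfk (graph_riccati_adjoint hQ hfk)
  rw [sub_eq_zero.1 hZ]
  exact hT h

/-- If `(T h)(y) = P(y) h`, then `X T* f = ∫ X P(y)* f(y) dy` for every bounded `X`. -/
theorem apply_adjoint_eq_rowOp {H' G : Type*} [NormedAddCommGroup H'] [InnerProductSpace ℂ H']
    [CompleteSpace H'] [NormedAddCommGroup G] [InnerProductSpace ℂ G] [CompleteSpace G]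
    (hθ : 1 / 2 < θ) {T : H' →L[ℂ] C.H} {P : (y : C.Pt) → H' →L[ℂ] C.Fib y}
    (hT : ∀ h, ∀ᵐ y ∂C.meas, C.eval (T h) y = P y h)
    (X : H' →L[ℂ] G) {M' : ℝ} (hM' : 0 ≤ M') (hX : IsRow θ M' fun y => X ∘L (P y).adjoint)
    (f : C.H) : X (T.adjoint f) = rowOp (fun y => X ∘L (P y).adjoint) f := by
  refine ext_inner_left ℂ fun g => ?_
  rw [hX.rowOp_apply hθ hM', ← integral_inner (hX.integrable hθ f),
    ← ContinuousLinearMap.adjoint_inner_left, ContinuousLinearMap.adjoint_inner_right,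
    Channel.inner_eq_integral]
  refine integral_congr_ae ?_
  filter_upwards [hT (X.adjoint g)] with y hy
  rw [hy, ← ContinuousLinearMap.adjoint_inner_right, ContinuousLinearMap.adjoint_inner_left]
  rfl

end Spectral

/-! ### Hilbert-Schmidt bound and construction of the kernels -/

section Main

variable {D : Channel.{v}} {C : Channel.{u}} {θ γ M : ℝ} {N : ℕ}

theorem Channel.lintegral_enorm_sq (f : C.H) :
    ∫⁻ x, ‖C.eval f x‖ₑ ^ 2 ∂C.meas = ‖f‖ₑ ^ 2 := by
  have h := ofReal_integral_eq_lintegral_ofReal (Channel.integrable_norm_sq f)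
    (Filter.Eventually.of_forall fun x => by positivity)
  rw [← Channel.norm_sq_eq_integral, ENNReal.ofReal_pow (norm_nonneg _), ofReal_norm] at h
  rw [h]
  refine lintegral_congr fun x => ?_
  rw [ENNReal.ofReal_pow (norm_nonneg _), ofReal_norm]

theorem measurable_enorm_eval (f : C.H) : Measurable fun y => ‖C.eval f y‖ₑ := by
  refine measurable_fun_sum (measurable_of_countable _) ?_
  exact (Lp.stronglyMeasurable f.snd).enorm

theorem KernelBound.measurable_enorm {F : OpKernel D C} (hF : KernelBound θ γ M F) (hγ : 0 < γ)
    (x : D.Pt) : Measurable fun y => ‖F x y‖ₑ := by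
  refine measurable_fun_sum (measurable_of_countable _) ?_
  exact (hF.continuous_right hγ x).enorm.measurable

/-- Cauchy-Schwarz in `y`, then integration in `x`. Working with lower integrals avoids any question
of measurability of the inner integral in `x`. -/
theorem KernelBound.norm_le_hsNorm {F : OpKernel D C} (hF : KernelBound θ γ M F) (hγ : 0 < γ)
    {B : C.H →L[ℂ] D.H} (hB : IsIntegralOperator B F) (hfin : hsNorm F ≠ ∞) :
    ‖B‖ ≤ (hsNorm F).toReal := by
  refine ContinuousLinearMap.opNorm_le_bound _ ENNReal.toReal_nonneg fun f => ?_
  have hpt : ∀ᵐ x ∂D.meas, ‖D.eval (B f) x‖ₑ ^ 2 ≤ (∫⁻ y, ‖F x y‖ₑ ^ 2 ∂C.meas) * ‖f‖ₑ ^ 2 := by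
    filter_upwards [hB f] with x hx
    have h1 : ‖D.eval (B f) x‖ₑ ≤ ∫⁻ y, ‖F x y‖ₑ * ‖C.eval f y‖ₑ ∂C.meas := by
      rw [hx.2]
      refine (enorm_integral_le_lintegral_enorm _).trans (lintegral_mono fun y => ?_)
      exact (F x y).le_opENorm _
    have h2 := ENNReal.lintegral_mul_le_Lp_mul_Lq C.meas (p := 2) (q := 2)
      ⟨by norm_num, by norm_num, by norm_num⟩ (hF.measurable_enorm hγ x).aemeasurable
      (measurable_enorm_eval f).aemeasurable
    simp only [Pi.mul_apply, ENNReal.rpow_two] at h2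
    rw [Channel.lintegral_enorm_sq, ← ENNReal.mul_rpow_of_nonneg _ _ (by norm_num)] at h2
    calc _ ≤ (((∫⁻ y, ‖F x y‖ₑ ^ 2 ∂C.meas) * ‖f‖ₑ ^ 2) ^ (1 / 2 : ℝ)) ^ 2 := by
          gcongr
          exact h1.trans h2
      _ = _ := by
          rw [← ENNReal.rpow_two, ← ENNReal.rpow_mul]
          norm_num
  have h3 : ‖B f‖ₑ ^ 2 ≤ (hsNorm F * ‖f‖ₑ) ^ 2 := by
    rw [← Channel.lintegral_enorm_sq, mul_pow]
    refine (lintegral_mono_ae hpt).trans (le_of_eq ?_)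
    rw [lintegral_mul_const' _ _ (by simp), hsNorm]
    congr 1
    rw [← ENNReal.rpow_two, ← ENNReal.rpow_mul]
    norm_num
  have h4 : ‖B f‖ₑ ≤ hsNorm F * ‖f‖ₑ := (ENNReal.pow_le_pow_left_iff two_ne_zero).1 h3
  have h5 := ENNReal.toReal_mono (ENNReal.mul_ne_top hfin (by simp)) h4
  rwa [ENNReal.toReal_mul, toReal_enorm, toReal_enorm] at h5

theorem Channel.IsResolventAt.unique {W R R' : C.H →L[ℂ] C.H} {z : ℂ} (h : C.IsResolventAt W z R)
    (h' : C.IsResolventAt W z R') : R = R' := by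
  refine sub_eq_zero.1 ((h.sub_eq h').trans ?_)
  rw [sub_self]
  exact zero_smul ℂ (R ∘L R')

/-- Here `f = (A_C - x)⁻¹ g`. The scalar `1 / (y - x)` depends on the base point `x`, so it is moved
from the vector into the kernel. -/
theorem rowOp_sub_rowOp_eq {M' M'' : ℝ} (hθ : 1 / 2 < θ) (hγ : 0 < γ) (hM : 0 ≤ M) (hM' : 0 ≤ M')
    (hM'' : 0 ≤ M'') {b V : OpKernel D C} (hb : KernelBound θ γ M b) (hV : KernelBound θ γ M' V)
    (hq : KernelBound θ γ M'' (smulKernel (fun x y => (y - x)⁻¹) fun x y => b x y + -V x y))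
    {x : D.Pt} {f g : C.H}
    (hfg : ∀ᵐ y ∂C.meas, C.eval f y = ((C.pos y : ℂ) - (D.pos x : ℂ))⁻¹ • C.eval g y) :
    rowOp (b x) f - rowOp (V x) f =
      rowOp (smulKernel (fun x y => (y - x)⁻¹) (fun x y => b x y + -V x y) x) g := by
  rw [hb.rowOp_apply hθ hγ hM, hV.rowOp_apply hθ hγ hM', hq.rowOp_apply hθ hγ hM'',
    ← integral_sub ((hb.isRow hγ x).integrable hθ f) ((hV.isRow hγ x).integrable hθ f)]
  refine integral_congr_ae ?_
  filter_upwards [hfg] with y hy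
  rw [hy, map_smul, map_smul, ← smul_sub, ← Complex.ofReal_sub, ← Complex.ofReal_inv,
    sub_eq_add_neg (b x y (C.eval g y))]
  rfl

theorem rowOp_adjoint_comp {M' : ℝ} {H' : Type*} [NormedAddCommGroup H'] [InnerProductSpace ℂ H']
    [CompleteSpace H'] (hθ : 1 / 2 < θ) (hγ : 0 < γ) (hM' : 0 ≤ M')
    {T : H' →L[ℂ] C.H} {P : (y : C.Pt) → H' →L[ℂ] C.Fib y}
    (hT : ∀ h, ∀ᵐ y ∂C.meas, C.eval (T h) y = P y h) {X : (x : D.Pt) → H' →L[ℂ] D.Fib x}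
    (hV : KernelBound θ γ M' (compKernel X P)) (x : D.Pt) (f : C.H) :
    X x (T.adjoint f) = rowOp (compKernel X P x) f :=
  apply_adjoint_eq_rowOp hθ hT (X x) (mul_nonneg hM' (Channel.wt_pos (C := D) (θ := θ) x).le)
    (hV.isRow hγ x) f

/-- The second resolvent identity `R = F - R W F`, with `F` on the right: the factor `1 / (y - x)`
then acts next to `g`, where it becomes part of the kernel. -/
theorem apply_resolvent {W R F : C.H →L[ℂ] C.H} {G : Type*} [NormedAddCommGroup G]
    [NormedSpace ℂ G] {z : ℂ} (hR : C.IsResolventAt W z R)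
    (hF : ∀ g, Channel.Graph (F g) (g + z • F g)) (X : C.H →L[ℂ] G) (g : C.H) :
    X (R g) = X (F g) - X (R (W (F g))) := by
  have h1 := hR.apply (hF g)
  rw [add_right_comm, add_sub_cancel_right, map_add] at h1
  rw [eq_sub_of_add_eq h1, map_sub]

/-- If the resolvents are uniformly bounded, then `Q` and `B* Q` are integral operators with kernels
in the weighted Hölder class. -/
theorem exists_kernels (hθ : 1 / 2 < θ) (hγ₀ : 0 < γ) (hγ₁ : γ < 1) (hC : C.σd.card ≤ N)
    (hD : D.σd.card ≤ N) {d : ℝ} (hd : 0 < d) (hdist : ∀ l ∈ C.σ, ∀ m ∈ D.σ, d ≤ |l - m|)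
    {B Q : C.H →L[ℂ] D.H} {b : OpKernel D C} (hB : IsIntegralOperator B b) (hM : 0 ≤ M)
    (hb : KernelBound θ γ M b) {R : ℝ → C.H →L[ℂ] C.H}
    (hR : ∀ m ∈ D.σ, C.IsResolventAt (B.adjoint ∘L Q) (m : ℂ) (R m))
    (hQ : HasSpectralIntegral D C B R Q) {K₁ K₂ : ℝ} (hK₁ : 0 ≤ K₁) (hK₂ : 0 ≤ K₂)
    (hRK : ∀ m ∈ D.σ, ‖R m‖ ≤ K₁) {S : ℝ → D.H →L[ℂ] D.H}
    (hS : ∀ l ∈ C.σ, D.IsResolventAt (B ∘L (-Q.adjoint)) (l : ℂ) (S l))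
    (hSK : ∀ l ∈ C.σ, ‖S l‖ ≤ K₂) :
    (∃ q : OpKernel D C, IsIntegralOperator Q q ∧
      KernelBound θ γ (1 / d * (1 + 2 * d ^ (-γ)) ^ 2 * (M + 4 * wtConst θ N ^ 4 *
        (K₁ * (1 + K₁ ^ γ) * (K₂ * (1 + K₂ ^ γ))) * M ^ 3)) q) ∧
    ∃ w : OpKernel C C, IsIntegralOperator (B.adjoint ∘L Q) w ∧
      KernelBound θ γ (2 * wtConst θ N ^ 2 * (K₂ * (1 + K₂ ^ γ)) * M ^ 2) w := by
  have hθ₀ : 0 ≤ θ := by linarith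
  have hκ : 0 ≤ wtConst θ N := zero_le_one.trans (one_le_wtConst θ N)
  have hκM : 0 ≤ wtConst θ N * M := mul_nonneg hκ hM
  have hK₁γ : 0 ≤ K₁ ^ γ := Real.rpow_nonneg hK₁ γ
  have hK₂γ : 0 ≤ K₂ ^ γ := Real.rpow_nonneg hK₂ γ
  set X : (x : D.Pt) → C.H →L[ℂ] D.Fib x := fun x => rowOp (b x)
  set Y : (y : C.Pt) → D.H →L[ℂ] C.Fib y := fun y => rowOp (b.adj y)
  have hX : IsHolderFamily θ γ (wtConst θ N * M) X := hb.isHolderFamily hθ hγ₀ hC hM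
  have hY : IsHolderFamily θ γ (wtConst θ N * M) Y := hb.adj.isHolderFamily hθ hγ₀ hD hM
  have hBX : ∀ f, ∀ᵐ x ∂D.meas, D.eval (B f) x = X x f :=
    (hb.isIntegralOperator_iff hθ hγ₀ hM).1 hB
  have hBY : ∀ h, ∀ᵐ y ∂C.meas, C.eval (B.adjoint h) y = Y y h :=
    hb.adjoint_apply hθ hγ₀ hM hB
  have hBn : ‖B.adjoint‖ ≤ wtConst θ N * (wtConst θ N * M) :=
    norm_le_of_eval_eq hY hθ hC hκM hBY
  have hQX := eval_spectralIntegral hθ hκM hX hBX hQ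
  set P : (y : C.Pt) → D.H →L[ℂ] C.Fib y := fun y => -(Y y ∘L S (C.pos y))
  have hM₂ : 0 ≤ wtConst θ N * M * (2 * (K₂ * (1 + K₂ ^ γ))) := by positivity
  have hM₁ : 0 ≤ wtConst θ N * M * (2 * (K₁ * (1 + K₁ ^ γ))) := by positivity
  have hP : IsHolderFamily θ γ (wtConst θ N * M * (2 * (K₂ * (1 + K₂ ^ γ)))) P :=
    (hY.comp_resolvent hθ₀ hκM hK₂ hγ₀ hγ₁ hS hSK).neg
  have hQP : ∀ h, ∀ᵐ y ∂C.meas, C.eval (Q.adjoint h) y = P y h :=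
    eval_adjoint hθ hγ₀ hM₂ (fun f k hfk => graph_riccati hBX hR hQX hfk) hBY hP hK₂ hS hSK
  have hXR := hX.comp_resolvent hθ₀ hκM hK₁ hγ₀ hγ₁ hR hRK
  have hXRB := hXR.comp_const B.adjoint hBn hM₁
  -- The factors are `X R`, of size `2κM K₁(1 + K₁^γ)`, then `B*`, of norm at most `κ²M`, and `P`,
  -- of size `2κM K₂(1 + K₂^γ)`, where `κ = wtConst θ N`. Their product is the cubic term, with
  -- coefficient `4κ⁴`.
  have hV := hXRB.compKernel hP
  have hW := hY.compKernel hP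
  have hMV : 0 ≤ wtConst θ N * M * (2 * (K₁ * (1 + K₁ ^ γ))) *
      (wtConst θ N * (wtConst θ N * M)) *
      (wtConst θ N * M * (2 * (K₂ * (1 + K₂ ^ γ)))) := by positivity
  have hMW : 0 ≤ wtConst θ N * M * (wtConst θ N * M * (2 * (K₂ * (1 + K₂ ^ γ)))) := by positivity
  refine ⟨?_, compKernel Y P, ?_, hW.mono (le_of_eq (by ring))⟩
  · have hbV := hb.add hV.neg
    have hMbV := add_nonneg hM hMV
    have hq := hbV.cauchy hθ₀ hMbV hd hγ₀ hγ₁ hdist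
    have hMq := mul_nonneg (by positivity : 0 ≤ 1 / d * (1 + 2 * d ^ (-γ)) ^ 2) hMbV
    refine ⟨_, (hq.isIntegralOperator_iff hθ hγ₀ hMq).2 fun g => ?_,
      hq.mono (le_of_eq (by ring))⟩
    filter_upwards [hQX g] with x hx
    rw [hx]
    have hz : ∀ y : C.Pt, d ≤ ‖(C.pos y : ℂ) - (D.pos x : ℂ)‖ := fun y => by
      rw [← Complex.ofReal_sub, Complex.norm_real]
      exact hdist _ (C.pos_mem y) _ (D.pos_mem x)
    obtain ⟨F, -, hFe, hFg, -⟩ := Channel.exists_free_resolvent hd hz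
    -- Writing `Q` as the adjoint of `Q*`, whose values are `P(y) h`, turns `X R B* Q` into an
    -- integral against `X(x) R(x) B* P(y)*`.
    have h3 := rowOp_adjoint_comp hθ hγ₀ hMV hQP hV x (F g)
    rw [ContinuousLinearMap.adjoint_adjoint] at h3
    refine ((apply_resolvent (hR _ (D.pos_mem x)) hFg (X x) g).trans
      (congrArg (X x (F g) - ·) h3)).trans ?_
    exact rowOp_sub_rowOp_eq hθ hγ₀ hM hMV hMq hb hV hq (hFe g)
  · refine (hW.isIntegralOperator_iff hθ hγ₀ hMW).2 fun f => ?_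
    filter_upwards [hBY (Q f)] with y hy
    have h3 := rowOp_adjoint_comp hθ hγ₀ hMW hQP hW y f
    rw [ContinuousLinearMap.adjoint_adjoint] at h3
    exact hy.trans h3

end Main

end TwoChannel

end

/-! ### The theorem: constants and the small coupling case -/

theorem lemma2 (θ : ℝ) (hθ : 1 / 2 < θ) (N : ℕ) :
    ∃ c : ℝ, 0 < c ∧
      ∀ (γ : ℝ), 1 / 2 < γ → γ < 1 →
      ∀ (Cα : TwoChannel.Channel.{u}) (Cβ : TwoChannel.Channel.{v}),
        Cα.σd.card ≤ N → Cβ.σd.card ≤ N →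
      ∀ (d₀ : ℝ), 0 < d₀ → (∀ l ∈ Cα.σ, ∀ m ∈ Cβ.σ, d₀ ≤ |l - m|) →
      -- the coupling operator `B_{βα}`, with `B_{αβ} = B_{βα}*`, and its kernel
      ∀ (B : Cα.H →L[ℂ] Cβ.H) (b : TwoChannel.OpKernel Cβ Cα),
        TwoChannel.IsIntegralOperator B b → TwoChannel.MemHolderClass θ γ b →
      ∀ (Q : Cα.H →L[ℂ] Cβ.H), TwoChannel.SolvesBasicEquation Cβ Cα B Q →
        (∀ Cαβ Cβα : ℝ, 0 < Cαβ → 0 < Cβα →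
          Cα.ResolventBound (B.adjoint ∘L Q) Cβ.σ Cαβ →
          Cβ.ResolventBound (B ∘L (-Q.adjoint)) Cα.σ Cβα →
          (∃ q : TwoChannel.OpKernel Cβ Cα,
            TwoChannel.IsIntegralOperator Q q ∧ TwoChannel.MemHolderClass θ γ q ∧
            TwoChannel.holderNorm θ γ q ≤
              ENNReal.ofReal (c / d₀ * (1 + d₀ ^ (-γ)) ^ 2) *
                (TwoChannel.holderNorm θ γ b +
                  ENNReal.ofReal (Cαβ * (1 + Cαβ ^ γ) * (Cβα * (1 + Cβα ^ γ))) *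
                    TwoChannel.holderNorm θ γ b ^ 3)) ∧
          (∃ w : TwoChannel.OpKernel Cα Cα,
            TwoChannel.IsIntegralOperator (B.adjoint ∘L Q) w ∧
            TwoChannel.MemHolderClass θ γ w ∧
            TwoChannel.holderNorm θ γ w ≤
              ENNReal.ofReal (c * (Cβα * (1 + Cβα ^ γ))) *
                TwoChannel.holderNorm θ γ b ^ 2)) ∧
        (∀ δ : ℝ, 0 < δ →
          TwoChannel.hsNorm b < ENNReal.ofReal (d₀ * min (1 / (1 + δ)) (δ / (1 + δ ^ 2))) →
          ‖Q‖ ≤ δ →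
          ∃ q : TwoChannel.OpKernel Cβ Cα,
            TwoChannel.IsIntegralOperator Q q ∧ TwoChannel.MemHolderClass θ γ q) := by
  have hκ := TwoChannel.one_le_wtConst θ N
  -- `64 = 4 · 4 · 4`: the number of suprema in the norm, the loss in `(1 + 2e)² ≤ 4 (1 + e)²`, and
  -- the two factors `2` from the Hölder bounds of the resolvents.
  refine ⟨64 * TwoChannel.wtConst θ N ^ 4, by positivity, ?_⟩
  intro γ hγ₂ hγ₁ Cα Cβ hα hβ d₀ hd hdist B b hB hbB Q hQ
  obtain ⟨R, hR, hint⟩ := hQ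
  have hγ₀ : 0 < γ := by linarith
  have hb := hbB.kernelBound
  set M := (TwoChannel.holderNorm θ γ b).toReal
  have hM : 0 ≤ M := ENNReal.toReal_nonneg
  have hbM : TwoChannel.holderNorm θ γ b = ENNReal.ofReal M := (ENNReal.ofReal_toReal hbB.ne).symm
  refine ⟨fun K₁ K₂ hK₁ hK₂ hres₁ hres₂ => ?_, fun δ hδ hhs hQδ => ?_⟩
  · have hdiv : ∀ {K t : ℝ}, 0 < K → K / (1 + |t|) ≤ K := fun {K t} hK =>
      div_le_self hK.le (le_add_of_nonneg_right (abs_nonneg _))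
    have hRK : ∀ m ∈ Cβ.σ, ‖R m‖ ≤ K₁ := by
      intro m hm
      obtain ⟨R', hR', hn⟩ := hres₁ m hm
      -- The bound concerns some resolvent and the basic equation another; both are the same
      -- operator.
      rw [(hR m hm).unique hR']
      exact hn.trans (hdiv hK₁)
    choose! S hS hSn using hres₂
    have hSK : ∀ l ∈ Cα.σ, ‖S l‖ ≤ K₂ := fun l hl => (hSn l hl).trans (hdiv hK₂)
    obtain ⟨⟨q, hq, hqb⟩, w, hw, hwb⟩ := TwoChannel.exists_kernels hθ hγ₀ hγ₁ hα hβ hd hdist hB hM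
      hb hR hint hK₁.le hK₂.le hRK hS hSK
    have hK₁γ : 0 ≤ K₁ ^ γ := Real.rpow_nonneg hK₁.le γ
    have hK₂γ : 0 ≤ K₂ ^ γ := Real.rpow_nonneg hK₂.le γ
    have hqn := hqb.holderNorm_le (by positivity)
    have hwn := hwb.holderNorm_le (by positivity)
    have hκ2 : 1 ≤ TwoChannel.wtConst θ N ^ 2 := one_le_pow₀ hκ
    have hκ4 : 1 ≤ TwoChannel.wtConst θ N ^ 4 := one_le_pow₀ hκ
    refine ⟨⟨q, hq, hqn.trans_lt ENNReal.ofReal_lt_top, hqn.trans ?_⟩,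
      w, hw, hwn.trans_lt ENNReal.ofReal_lt_top, hwn.trans ?_⟩
    · rw [hbM, ← ENNReal.ofReal_pow hM, ← ENNReal.ofReal_mul (by positivity),
        ← ENNReal.ofReal_add hM (by positivity), ← ENNReal.ofReal_mul (by positivity)]
      refine ENNReal.ofReal_le_ofReal ?_
      set e := d₀ ^ (-γ) with he
      have he0 : 0 ≤ e := Real.rpow_nonneg hd.le _
      set g := K₁ * (1 + K₁ ^ γ) * (K₂ * (1 + K₂ ^ γ)) with hg
      have hg0 : 0 ≤ g := by positivity
      have h1 : (1 + 2 * e) ^ 2 ≤ 4 * (1 + e) ^ 2 := by nlinarith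
      have h2 : M + 4 * TwoChannel.wtConst θ N ^ 4 * g * M ^ 3 ≤
          4 * TwoChannel.wtConst θ N ^ 4 * (M + g * M ^ 3) := by
        nlinarith [mul_le_mul_of_nonneg_right hκ4 hM]
      calc 4 * (1 / d₀ * (1 + 2 * e) ^ 2 * (M + 4 * TwoChannel.wtConst θ N ^ 4 * g * M ^ 3))
          ≤ 4 * (1 / d₀ * (4 * (1 + e) ^ 2) *
            (4 * TwoChannel.wtConst θ N ^ 4 * (M + g * M ^ 3))) := by gcongr
        _ = 64 * TwoChannel.wtConst θ N ^ 4 / d₀ * (1 + e) ^ 2 * (M + g * M ^ 3) := by ring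
    · rw [hbM, ← ENNReal.ofReal_pow hM, ← ENNReal.ofReal_mul (by positivity)]
      refine ENNReal.ofReal_le_ofReal ?_
      have h1 : TwoChannel.wtConst θ N ^ 2 ≤ TwoChannel.wtConst θ N ^ 4 :=
        pow_le_pow_right₀ hκ (by norm_num)
      calc 4 * (2 * TwoChannel.wtConst θ N ^ 2 * (K₂ * (1 + K₂ ^ γ)) * M ^ 2)
          = 8 * TwoChannel.wtConst θ N ^ 2 * (K₂ * (1 + K₂ ^ γ)) * M ^ 2 := by ring
        _ ≤ 64 * TwoChannel.wtConst θ N ^ 4 * (K₂ * (1 + K₂ ^ γ)) * M ^ 2 := by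
            gcongr
            norm_num
        _ = _ := by ring
  · have hBn : ‖B‖ < d₀ * (1 / (1 + δ)) := by
      refine (hb.norm_le_hsNorm hγ₀ hB hhs.ne_top).trans_lt ?_
      refine (ENNReal.lt_ofReal_iff_toReal_lt hhs.ne_top).1 (hhs.trans_le ?_)
      exact ENNReal.ofReal_le_ofReal (by gcongr; exact min_le_left _ _)
    -- Since `‖B‖ < d₀ / (1 + δ)` and `‖Q‖ ≤ δ`, the product is below `d₀`. Both `B*Q` and `-B Q*`
    -- are then smaller than the gap.
    have hprod : ‖B‖ * ‖Q‖ < d₀ := by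
      calc ‖B‖ * ‖Q‖ ≤ d₀ * (1 / (1 + δ)) * δ :=
            mul_le_mul hBn.le hQδ (norm_nonneg Q) (by positivity)
        _ = d₀ * (δ / (1 + δ)) := by ring
        _ < d₀ * 1 := by
            gcongr
            rw [div_lt_one (by linarith)]
            linarith
        _ = d₀ := mul_one _
    have hW₁ : ‖B.adjoint ∘L Q‖ < d₀ :=
      ((ContinuousLinearMap.opNorm_comp_le _ _).trans_eq
        (by rw [LinearIsometryEquiv.norm_map])).trans_lt hprod
    have hW₂ : ‖B ∘L (-Q.adjoint)‖ < d₀ :=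
      ((ContinuousLinearMap.opNorm_comp_le _ _).trans_eq
        (by rw [norm_neg, LinearIsometryEquiv.norm_map])).trans_lt hprod
    have hz₁ : ∀ m ∈ Cβ.σ, ∀ y : Cα.Pt, d₀ ≤ ‖(Cα.pos y : ℂ) - (m : ℂ)‖ := fun m hm y => by
      rw [← Complex.ofReal_sub, Complex.norm_real]
      exact hdist _ (Cα.pos_mem y) _ hm
    have hz₂ : ∀ l ∈ Cα.σ, ∀ x : Cβ.Pt, d₀ ≤ ‖(Cβ.pos x : ℂ) - (l : ℂ)‖ := fun l hl x => by
      rw [← Complex.ofReal_sub, Complex.norm_real, Real.norm_eq_abs, abs_sub_comm]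
      exact hdist _ hl _ (Cβ.pos_mem x)
    -- The basic equation provides resolvents only in the channel `α`; those in the channel `β` come
    -- from the Neumann series.
    have hex : ∀ l ∈ Cα.σ, ∃ S, Cβ.IsResolventAt (B ∘L (-Q.adjoint)) (l : ℂ) S :=
      fun l hl => TwoChannel.Channel.exists_resolvent (hz₂ l hl) hW₂
    choose! S hS using hex
    obtain ⟨⟨q, hq, hqb⟩, -⟩ := TwoChannel.exists_kernels hθ hγ₀ hγ₁ hα hβ hd hdist hB hM
      hb hR hint (one_div_pos.2 (sub_pos.2 hW₁)).le (one_div_pos.2 (sub_pos.2 hW₂)).le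
      (fun m hm => (hR m hm).norm_le (hz₁ m hm) hW₁) hS
      (fun l hl => (hS l hl).norm_le (hz₂ l hl) hW₂)
    have hp : ∀ {a : ℝ}, 0 < d₀ - a → 0 ≤ (1 / (d₀ - a)) ^ γ := fun h =>
      Real.rpow_nonneg (one_div_pos.2 h).le γ
    have hp₁ := hp (sub_pos.2 hW₁)
    have hp₂ := hp (sub_pos.2 hW₂)
    have hr₁ := (one_div_pos.2 (sub_pos.2 hW₁)).le
    have hr₂ := (one_div_pos.2 (sub_pos.2 hW₂)).le
    exact ⟨q, hq, (hqb.holderNorm_le (by positivity)).trans_lt ENNReal.ofReal_lt_top⟩
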